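/- Let $N,m\ge 1$ be integers, let $\Omega\subset\mathbb{R}^N$ be a bounded convex open set with volume $|\Omega|$, and let $d(x)=\operatorname{dist}(x,\partial\Omega)$. Let $a_N$ be the volume of the unit ball of $\mathbb{R}^N$ and put $$A(m)=\frac{1^2\cdot 3^2\cdots(2m-1)^2}{4^m},\qquad \Gamma(m)=\frac{N(N+2)\cdots(N+2m-2)}{1\cdot 3\cdots(2m-1)}\Big(\sum_{i=1}^m\frac{1}{2^{m+i}}\prod_{k=1}^i(2k-1)^2\Big)a_N^{2m/N}.$$ Then for every real-valued $u\in C_c^\infty(\Omega)$, $$\int_\Omega(\Delta^{m/2}u)^2\,dx\ \ge\ A(m)\int_\Omega\frac{u^2}{d^{2m}}\,dx+\Gamma(m)\,|\Omega|^{-2m/N}\int_\Omega u^2\,dx,$$ where for odd $m$ the left-hand side stands for $\int_\Omega|\nabla\Delta^{(m-1)/2}u|^2\,dx$. -/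

import Mathlib

open MeasureTheory
open scoped ContDiff

noncomputable section

namespace HardyRellich

/-- The integrand `(Δ^{m/2} u)^2`: the square of the `m/2`-fold Laplacian of `u` when `m` is even,
and `|∇ Δ^{(m-1)/2} u|^2` when `m` is odd (then `m / 2`, rounded down, is `(m - 1) / 2`). -/
def energyDensity {N : ℕ} (m : ℕ) (u : EuclideanSpace ℝ (Fin N) → ℝ)
    (x : EuclideanSpace ℝ (Fin N)) : ℝ :=
  if Even m then ((Laplacian.laplacian^[m / 2] u) x) ^ 2
  else ‖gradient (Laplacian.laplacian^[m / 2] u) x‖ ^ 2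

/-- The distance from `x` to the boundary of `Ω`. -/
def bdryDist {N : ℕ} (Ω : Set (EuclideanSpace ℝ (Fin N))) (x : EuclideanSpace ℝ (Fin N)) : ℝ :=
  Metric.infDist x (frontier Ω)

/-- The constant `A(m) = 1² · 3² ⋯ (2m-1)² / 4^m`. -/
def constA (m : ℕ) : ℝ :=
  (∏ k ∈ Finset.Icc 1 m, (2 * (k : ℝ) - 1) ^ 2) / 4 ^ m

/-- The volume of the unit ball in `ℝ^N`. -/
def unitBallVolume (N : ℕ) : ℝ :=
  volume.real (Metric.ball (0 : EuclideanSpace ℝ (Fin N)) 1)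

/-- The constant
`Γ(m) = N(N+2)⋯(N+2m-2) / (1·3⋯(2m-1)) · (∑_{i=1}^m 2^{-(m+i)} ∏_{k=1}^i (2k-1)²) · a_N^{2m/N}`,
where `a_N` is the volume of the unit ball in `ℝ^N`. -/
def constGamma (N m : ℕ) : ℝ :=
  (∏ k ∈ Finset.Icc 1 m, ((N : ℝ) + 2 * (k : ℝ) - 2)) /
      (∏ k ∈ Finset.Icc 1 m, (2 * (k : ℝ) - 1)) *
    (∑ i ∈ Finset.Icc 1 m, 1 / (2 : ℝ) ^ (m + i) * ∏ k ∈ Finset.Icc 1 i, (2 * (k : ℝ) - 1) ^ 2) *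
    unitBallVolume N ^ (2 * (m : ℝ) / (N : ℝ))

end HardyRellich

end

/-! The inequality is an average of one-dimensional ones over all directions. On an interval of
length `2b`, the function `f` satisfies `∫ (f^(m))² ≥ ∫ f² (A(m) ρ^(-2m) + R(m) b^(-2m))`, where `ρ`
is the distance to the nearer endpoint and `R(m)` is `remainderConst m`
(`lintegral_hardyRellich_interval`). Since `Ω` is convex, every line meets it in an interval or not
at all, so slicing gives the inequality for `∂_θ^m u` with the weight `rayWeight`
(`lintegral_rayWeight_le`).

Both sides are then integrated over the unit sphere. By Plancherel, `∂_θ^m` contributes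
`⟨ξ,θ⟩^(2m)`, whose spherical mean is `1·3⋯(2m-1) / (N(N+2)⋯(N+2m-2))` times `|ξ|^(2m)`; hence the
left side becomes a multiple of the polyharmonic energy (`lintegral_sphere_lineDerivOp_sq`). In the
weight, a supporting hyperplane with unit normal `n` at a nearest boundary point gives `ρ ≤ d(x) /
|⟨n,θ⟩|`, and the same spherical moment reappears, so `A(m)` survives unchanged
(`exists_normal_le_inv_rayLength`). The half chord `b(θ)` through `x` has mean `N`-th power at most
`|Ω| / a_N`, because the volume of `Ω` in polar coordinates about `x` is governed by the ray
lengths; a Jensen-type argument then bounds the mean of `b(θ)^(-2m)` below by its value for the ball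
of volume `|Ω|` (`le_lintegral_half_chord`). In this term the moment does not cancel, and its
inverse is the first factor of `Γ(m)`.

Nearly everything is stated with lower integrals, so that Tonelli applies without integrability
conditions. -/

namespace HardyRellich

/-! ### One-dimensional Hardy–Rellich inequalities with remainder. -/

/-- The factor `∑_{i=1}^m 2^{-(m+i)} ∏_{k=1}^i (2k-1)²` of `constGamma`. -/
noncomputable def remainderConst (m : ℕ) : ℝ :=
  ∑ i ∈ Finset.Icc 1 m, 1 / (2 : ℝ) ^ (m + i) * ∏ k ∈ Finset.Icc 1 i, (2 * (k : ℝ) - 1) ^ 2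

lemma constA_zero : constA 0 = 1 := by simp [constA]

lemma constA_succ (m : ℕ) : constA (m + 1) = constA m * ((2 * m + 1) ^ 2 / 4) := by
  unfold constA
  rw [Finset.prod_Icc_succ_top (by omega), pow_succ]
  push_cast
  field_simp
  ring

lemma constA_nonneg (m : ℕ) : 0 ≤ constA m := by
  unfold constA
  positivity

lemma remainderConst_zero : remainderConst 0 = 0 := by simp [remainderConst]

/-- This recursion is the one produced by the induction on the order in `hardyRellich_half`. -/
lemma remainderConst_succ (m : ℕ) :
    remainderConst (m + 1) = constA (m + 1) + remainderConst m / 2 := by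
  unfold remainderConst
  rw [Finset.sum_Icc_succ_top (by omega), Finset.sum_div, add_comm, constA]
  congr 1
  · have : (2 : ℝ) ^ (m + 1 + (m + 1)) = 4 ^ (m + 1) := by
      rw [← two_mul, pow_mul]; norm_num
    rw [this]; ring
  · refine Finset.sum_congr rfl fun i _ => ?_
    rw [show m + 1 + i = (m + i) + 1 by ring, pow_succ]
    field_simp

lemma remainderConst_nonneg (m : ℕ) : 0 ≤ remainderConst m := by
  unfold remainderConst
  positivity

lemma continuousOn_inv_pow {ε b : ℝ} (hε : 0 < ε) (n : ℕ) :
    ContinuousOn (fun t : ℝ => t⁻¹ ^ n) (Set.Icc ε b) := by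
  refine ContinuousOn.pow (continuousOn_inv₀.mono ?_) n
  intro t ht
  exact (hε.trans_le ht.1).ne'

/-- The weighted one-dimensional Hardy inequality with remainder on `[ε, b]`. -/
lemma weighted_hardy_half (k : ℕ) {ε b : ℝ} (hε : 0 < ε) (hεb : ε ≤ b) {f : ℝ → ℝ}
    (hf : ContDiff ℝ ∞ f) (h0 : f ε = 0) :
    (2 * k + 1) ^ 2 / 4 * ((∫ t in ε..b, f t ^ 2 * t⁻¹ ^ (2 * k + 2)) +
      b⁻¹ ^ (2 * k + 2) * ∫ t in ε..b, f t ^ 2) ≤ ∫ t in ε..b, deriv f t ^ 2 * t⁻¹ ^ (2 * k) := by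
  have hb : 0 < b := hε.trans_le hεb
  have hu : Set.uIcc ε b = Set.Icc ε b := Set.uIcc_of_le hεb
  have hfc : Continuous f := hf.continuous
  have hdc : Continuous (deriv f) := hf.continuous_deriv (by simp)
  set c : ℝ := (2 * k + 1) / 2 with hc
  -- The weight `g` vanishes at `b` and `f` vanishes at `ε`, so `∫ (g f²)' = 0` with no condition on
  -- `f` at `b`. Subtracting this zero completes a square.
  set g : ℝ → ℝ := fun t => c * (t⁻¹ ^ (2 * k + 1) - b⁻¹ ^ (2 * k + 1)) with hg
  set g' : ℝ → ℝ := fun t => - (c * (2 * k + 1) * t⁻¹ ^ (2 * k + 2)) with hg'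
  have hgd : ∀ t ∈ Set.uIcc ε b, HasDerivAt (fun t => g t * f t ^ 2)
      (g' t * f t ^ 2 + g t * (2 * f t * deriv f t)) t := by
    intro t ht
    rw [hu] at ht
    have ht0 : t ≠ 0 := (hε.trans_le ht.1).ne'
    have h1 : HasDerivAt g (g' t) t := by
      have := (((hasDerivAt_inv ht0).pow (2 * k + 1)).sub_const (b⁻¹ ^ (2 * k + 1))).const_mul c
      refine this.congr_deriv ?_
      simp only [hg', Nat.add_sub_cancel]
      push_cast
      rw [pow_add t⁻¹, inv_pow t 2]
      ring
    have h2 : HasDerivAt f (deriv f t) t :=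
      (hf.differentiable (by simp)).differentiableAt.hasDerivAt
    refine (h1.mul (h2.pow 2)).congr_deriv ?_
    simp only [Pi.pow_apply]
    push_cast
    ring
  have hgc : ContinuousOn g (Set.Icc ε b) :=
    ((continuousOn_inv_pow hε _).sub continuousOn_const).const_smul c
  have hgc' : ContinuousOn g' (Set.Icc ε b) :=
    (((continuousOn_inv_pow hε _)).const_smul (c * (2 * k + 1))).neg
  have hDc : ContinuousOn (fun t => g' t * f t ^ 2 + g t * (2 * f t * deriv f t))
      (Set.Icc ε b) :=
    (hgc'.mul (hfc.pow 2).continuousOn).add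
      (hgc.mul ((continuous_const.mul hfc).mul hdc).continuousOn)
  have hint : ∫ t in ε..b, (g' t * f t ^ 2 + g t * (2 * f t * deriv f t)) = 0 := by
    rw [intervalIntegral.integral_eq_sub_of_hasDerivAt hgd
      (ContinuousOn.intervalIntegrable (hu ▸ hDc))]
    simp [hg, h0]
  have hI1 : IntervalIntegrable (fun t => f t ^ 2 * t⁻¹ ^ (2 * k + 2)) volume ε b :=
    ContinuousOn.intervalIntegrable
      (hu ▸ (hfc.pow 2).continuousOn.mul (continuousOn_inv_pow hε _))
  have hI2 : IntervalIntegrable (fun t => f t ^ 2) volume ε b := (hfc.pow 2).intervalIntegrable _ _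
  have hI3 : IntervalIntegrable (fun t => deriv f t ^ 2 * t⁻¹ ^ (2 * k)) volume ε b :=
    ContinuousOn.intervalIntegrable
      (hu ▸ (hdc.pow 2).continuousOn.mul (continuousOn_inv_pow hε _))
  have hI4 := ContinuousOn.intervalIntegrable (μ := volume) (hu ▸ hDc)
  rw [← sub_nonneg, ← intervalIntegral.integral_const_mul, ← intervalIntegral.integral_add hI1
    (hI2.const_mul _), ← intervalIntegral.integral_const_mul]
  rw [← intervalIntegral.integral_sub hI3 ((hI1.add (hI2.const_mul _)).const_mul _)]
  rw [← sub_zero (∫ t in ε..b, _), ← hint, ← intervalIntegral.integral_sub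
    (hI3.sub ((hI1.add (hI2.const_mul _)).const_mul _)) hI4, hint]
  -- With `s = 1/t` and `a = 1/b`, the integrand is `(f' s^k - g s^(-k) f)²` plus `c² f²` times the
  -- quantity in `key`, which is nonnegative because `a ≤ s`.
  refine intervalIntegral.integral_nonneg hεb fun t ht => ?_
  have ht0 : 0 < t := hε.trans_le ht.1
  simp only [hg, hg']
  obtain ⟨s, hs, rfl⟩ : ∃ s, 0 < s ∧ t = s⁻¹ := ⟨t⁻¹, by positivity, by simp⟩
  obtain ⟨a, ha, rfl⟩ : ∃ a, 0 < a ∧ b = a⁻¹ := ⟨b⁻¹, by positivity, by simp⟩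
  have has : a ≤ s := by
    have := ht.2
    rwa [inv_le_inv₀ hs ha] at this
  simp only [inv_inv]
  have key : 0 ≤ a ^ (2 * k + 1) * (2 * s - a - a ^ (2 * k + 1) * (1 / s) ^ (2 * k)) := by
    have h1 : a ^ (2 * k) * (1 / s) ^ (2 * k) ≤ 1 := by
      rw [← mul_pow]
      refine pow_le_one₀ (by positivity) ?_
      rw [mul_one_div, div_le_one hs]; exact has
    have h2 : a ^ (2 * k + 1) * (1 / s) ^ (2 * k) ≤ a := by
      rw [pow_succ]; nlinarith
    exact mul_nonneg (by positivity) (by linarith)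
  have hss : (s * (1 / s)) = 1 := by field_simp
  have e1 : s ^ (2 * k) * (1 / s) ^ (2 * k) = 1 := by rw [← mul_pow, hss, one_pow]
  have e2 : s ^ k * (1 / s) ^ k = 1 := by rw [← mul_pow, hss, one_pow]
  have hsq := sq_nonneg (deriv f s⁻¹ * s ^ k - c * (s ^ (2 * k + 1) - a ^ (2 * k + 1)) *
    (1 / s) ^ k * f s⁻¹)
  have hf2 := mul_nonneg (mul_nonneg (sq_nonneg c) (sq_nonneg (f s⁻¹))) key
  generalize 1 / s = σ at *
  generalize deriv f s⁻¹ = F at *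
  generalize f s⁻¹ = G at *
  have hc2 : ((2 : ℝ) * k + 1) = 2 * c := by rw [hc]; ring
  rw [hc2]
  clear_value c
  refine (add_nonneg hsq hf2).trans_eq ?_
  simp only [pow_add, pow_mul, pow_one, mul_comm 2 k] at *
  generalize s ^ k = S at *
  generalize a ^ k = P at *
  generalize σ ^ k = T at *
  have e3 : T ^ 2 * S ^ 2 = 1 := by rw [← mul_pow, mul_comm T, e2, one_pow]
  linear_combination (-2 * c * F * G * (S ^ 2 * s - P ^ 2 * a)) * e2 +
    (c ^ 2 * G ^ 2 * (S ^ 2 * s ^ 2 - 2 * s * a * P ^ 2)) * e3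

/-- The higher-order one-dimensional Hardy–Rellich inequality on `[ε, b]`. -/
lemma hardyRellich_half (m : ℕ) {ε b : ℝ} (hε : 0 < ε) (hεb : ε ≤ b) {f : ℝ → ℝ}
    (hf : ContDiff ℝ ∞ f) (h0 : ∀ j, iteratedDeriv j f ε = 0) :
    constA m * (∫ t in ε..b, f t ^ 2 * t⁻¹ ^ (2 * m)) +
      remainderConst m * (b⁻¹ ^ (2 * m) * ∫ t in ε..b, f t ^ 2) ≤
        ∫ t in ε..b, iteratedDeriv m f t ^ 2 := by
  have hb : 0 < b := hε.trans_le hεb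
  have hu : Set.uIcc ε b = Set.Icc ε b := Set.uIcc_of_le hεb
  induction m generalizing f with
  | zero => simp [constA_zero, remainderConst_zero]
  | succ m ih =>
    have hf' : ContDiff ℝ ∞ (deriv f) := (contDiff_infty_iff_deriv.1 hf).2
    have hih := ih hf' (fun j => by simpa [iteratedDeriv_succ'] using h0 (j + 1))
    rw [iteratedDeriv_succ']
    refine le_trans ?_ hih
    have hf0 : f ε = 0 := by simpa using h0 0
    -- The induction hypothesis for `f'` has two terms. Weight `t^(-2m)` turns the first into
    -- `A(m+1)` times a Hardy term plus an equal multiple of the remainder. In the second, the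
    -- unweighted case together with `t ≤ b` gives `(1/4 + 1/4) b^(-2) ∫ f²`, whence the factor
    -- `1/2` in the recursion.
    have s1 := mul_le_mul_of_nonneg_left (weighted_hardy_half m hε hεb hf hf0) (constA_nonneg m)
    have s2 := weighted_hardy_half 0 hε hεb hf hf0
    have s3 : b⁻¹ ^ 2 * (∫ t in ε..b, f t ^ 2) ≤ ∫ t in ε..b, f t ^ 2 * t⁻¹ ^ 2 := by
      rw [← intervalIntegral.integral_const_mul]
      refine intervalIntegral.integral_mono_on hεb
        ((continuous_const.mul (hf.continuous.pow 2)).intervalIntegrable _ _)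
        (ContinuousOn.intervalIntegrable
          (hu ▸ (hf.continuous.pow 2).continuousOn.mul (continuousOn_inv_pow hε _)))
        fun t ht => ?_
      rw [mul_comm]
      have ht0 : 0 < t := hε.trans_le ht.1
      have := ht.2
      gcongr
    simp only [Nat.cast_zero, mul_zero, zero_add, pow_zero, mul_one, one_pow] at s2
    have s4 := mul_le_mul_of_nonneg_left (s2.trans' (mul_le_mul_of_nonneg_left
      (add_le_add_left s3 _) (by norm_num : (0 : ℝ) ≤ 1 / 4))) (mul_nonneg (remainderConst_nonneg m)
        (by positivity : 0 ≤ b⁻¹ ^ (2 * m)))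
    rw [remainderConst_succ, constA_succ, show 2 * (m + 1) = 2 * m + 2 by ring]
    rw [pow_add b⁻¹] at *
    linarith

/-- The one-dimensional inequality on a half interval, for functions vanishing near `0`. -/
lemma lintegral_hardyRellich_half (m : ℕ) {ε b : ℝ} (hε : 0 < ε) (hεb : ε < b) {f : ℝ → ℝ}
    (hf : ContDiff ℝ ∞ f) (h0 : ∀ t < 2 * ε, f t = 0) :
    ∫⁻ t in Set.Ioc 0 b, ENNReal.ofReal
      (f t ^ 2 * (constA m * t⁻¹ ^ (2 * m) + remainderConst m * b⁻¹ ^ (2 * m))) ≤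
    ∫⁻ t in Set.Ioc 0 b, ENNReal.ofReal (iteratedDeriv m f t ^ 2) := by
  have hb : 0 < b := hε.trans hεb
  have hu : Set.uIcc ε b = Set.Icc ε b := Set.uIcc_of_le hεb.le
  -- Vanishing up to `2ε` makes `f` zero in a neighbourhood of `ε`, so all derivatives vanish there.
  have hj : ∀ j, iteratedDeriv j f ε = 0 := by
    intro j
    have : f =ᶠ[nhds ε] fun _ => 0 := by
      filter_upwards [Iio_mem_nhds (show ε < 2 * ε by linarith)] with t ht using h0 t ht
    rw [(this.iteratedDeriv_eq j)]
    simp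
  have key := hardyRellich_half m hε hεb.le hf hj
  have hI1 : IntervalIntegrable (fun t => f t ^ 2 * t⁻¹ ^ (2 * m)) volume ε b :=
    ContinuousOn.intervalIntegrable
      (hu ▸ (hf.continuous.pow 2).continuousOn.mul (continuousOn_inv_pow hε _))
  have hI2 : IntervalIntegrable (fun t => f t ^ 2) volume ε b :=
    (hf.continuous.pow 2).intervalIntegrable _ _
  have hI3 : IntervalIntegrable (fun t => iteratedDeriv m f t ^ 2) volume ε b :=
    ((hf.continuous_iteratedDeriv m (by exact_mod_cast le_top)).pow 2).intervalIntegrable _ _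
  have hI4 : IntervalIntegrable (fun t => f t ^ 2 * (constA m * t⁻¹ ^ (2 * m) +
      remainderConst m * b⁻¹ ^ (2 * m))) volume ε b := by
    refine ((hI1.const_mul (constA m)).add
      (hI2.const_mul (remainderConst m * b⁻¹ ^ (2 * m)))).congr (fun t _ => ?_)
    ring
  have e1 : ∫ t in ε..b, f t ^ 2 * (constA m * t⁻¹ ^ (2 * m) +
      remainderConst m * b⁻¹ ^ (2 * m)) ≤ ∫ t in ε..b, iteratedDeriv m f t ^ 2 := by
    refine le_trans (le_of_eq ?_) key
    rw [← intervalIntegral.integral_const_mul, ← mul_assoc, ← intervalIntegral.integral_const_mul,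
      ← intervalIntegral.integral_add (hI1.const_mul _) (hI2.const_mul _)]
    refine intervalIntegral.integral_congr fun t _ => ?_
    ring
  rw [intervalIntegral.integral_of_le hεb.le, intervalIntegral.integral_of_le hεb.le] at e1
  have e2 : ∫⁻ t in Set.Ioc ε b, ENNReal.ofReal
      (f t ^ 2 * (constA m * t⁻¹ ^ (2 * m) + remainderConst m * b⁻¹ ^ (2 * m))) ≤
      ∫⁻ t in Set.Ioc ε b, ENNReal.ofReal (iteratedDeriv m f t ^ 2) := by
    rw [← ofReal_integral_eq_lintegral_ofReal hI4.1, ← ofReal_integral_eq_lintegral_ofReal hI3.1]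
    · exact ENNReal.ofReal_le_ofReal e1
    · exact Filter.Eventually.of_forall fun t => by positivity
    · refine (ae_restrict_iff' measurableSet_Ioc).2 (Filter.Eventually.of_forall fun t ht => ?_)
      have : 0 < t := hε.trans ht.1
      have := constA_nonneg m
      have := remainderConst_nonneg m
      positivity
  refine le_trans ?_ (e2.trans (lintegral_mono_set (Set.Ioc_subset_Ioc_left hε.le)))
  rw [← lintegral_indicator measurableSet_Ioc, ← lintegral_indicator measurableSet_Ioc]
  refine lintegral_mono fun t => ?_
  by_cases ht : ε < t
  · simp only [Set.indicator, Set.mem_Ioc, ht, hε.trans ht, le_refl]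
  · simp [Set.indicator, h0 t (by linarith)]

/-- The one-dimensional Hardy–Rellich inequality with remainder on a bounded interval. -/
lemma lintegral_hardyRellich_interval (m : ℕ) {α β : ℝ} {f : ℝ → ℝ}
    (hf : ContDiff ℝ ∞ f) (hc : HasCompactSupport f) (hs : tsupport f ⊆ Set.Ioo α β) :
    ∫⁻ t in Set.Ioo α β, ENNReal.ofReal
      (f t ^ 2 * (constA m * max (t - α)⁻¹ (β - t)⁻¹ ^ (2 * m) +
        remainderConst m * (2 / (β - α)) ^ (2 * m))) ≤
    ∫⁻ t, ENNReal.ofReal (iteratedDeriv m f t ^ 2) := by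
  rcases le_or_gt β α with hαβ | hαβ
  · simp [Set.Ioo_eq_empty_of_le hαβ]
  obtain ⟨ε, hε, hεb, h1, h2⟩ : ∃ ε, 0 < ε ∧ ε < (β - α) / 2 ∧ (∀ t < 2 * ε, f (α + t) = 0) ∧
      (∀ t < 2 * ε, f (β - t) = 0) := by
    obtain ⟨δ, hδ, h⟩ := hc.exists_cthickening_subset_open isOpen_Ioo hs
    have hz : ∀ t, f t ≠ 0 → α + δ ≤ t ∧ t ≤ β - δ := by
      intro t ht
      have ht' : Metric.closedBall t δ ⊆ Set.Ioo α β :=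
        (Metric.closedBall_subset_cthickening (subset_tsupport _ ht) δ).trans h
      rw [Real.closedBall_eq_Icc] at ht'
      have a1 := (ht' (Set.left_mem_Icc.2 (by linarith))).1
      have a2 := (ht' (Set.right_mem_Icc.2 (by linarith))).2
      constructor <;> linarith
    have hm1 := min_le_left (δ / 2) ((β - α) / 4)
    have hm2 := min_le_right (δ / 2) ((β - α) / 4)
    refine ⟨min (δ / 2) ((β - α) / 4), lt_min (by linarith) (by linarith), by linarith,
      fun t ht => ?_, fun t ht => ?_⟩
    · by_contra hne
      have := (hz _ hne).1
      linarith
    · by_contra hne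
      have := (hz _ hne).2
      linarith
  -- The interval is cut at its midpoint; on each half the maximum in the weight is the inverse
  -- distance to that half's own endpoint.
  set b := (β - α) / 2 with hb
  set W : ℝ → ENNReal := fun t => ENNReal.ofReal
      (f t ^ 2 * (constA m * max (t - α)⁻¹ (β - t)⁻¹ ^ (2 * m) +
        remainderConst m * (2 / (β - α)) ^ (2 * m))) with hW
  set D : ℝ → ENNReal := fun t => ENNReal.ofReal (iteratedDeriv m f t ^ 2) with hD
  have hbi : (2 / (β - α)) = b⁻¹ := by rw [hb, inv_div]
  have left : ∫⁻ t in Set.Ioc α (α + b), W t ≤ ∫⁻ t in Set.Ioc α (α + b), D t := by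
    have := lintegral_hardyRellich_half m hε hεb (f := fun t => f (α + t))
      (hf.comp (contDiff_const.add contDiff_id)) h1
    have hmp := measurePreserving_add_left (volume : Measure ℝ) α
    have hme := (Homeomorph.addLeft α).measurableEmbedding
    have hpre : (fun t => α + t) ⁻¹' Set.Ioc α (α + b) = Set.Ioc 0 b := by
      ext t; simp
    have c1 := hmp.setLIntegral_comp_preimage_emb hme W (Set.Ioc α (α + b))
    have c2 := hmp.setLIntegral_comp_preimage_emb hme D (Set.Ioc α (α + b))
    rw [hpre] at c1 c2
    rw [← c1, ← c2]
    refine le_trans (le_of_eq ?_) (this.trans (le_of_eq ?_))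
    · refine setLIntegral_congr_fun measurableSet_Ioc fun t ht => ?_
      simp only [hW, hbi]
      have hle : (β - (α + t))⁻¹ ≤ t⁻¹ := by
        have := ht.1
        have := ht.2
        exact inv_anti₀ ht.1 (by linarith)
      rw [add_sub_cancel_left, max_eq_left hle]
    · refine lintegral_congr fun t => ?_
      simp only [hD]
      rw [iteratedDeriv_comp_const_add]
  have right : ∫⁻ t in Set.Ico (β - b) β, W t ≤ ∫⁻ t in Set.Ico (β - b) β, D t := by
    have := lintegral_hardyRellich_half m hε hεb (f := fun t => f (β - t))
      (hf.comp (contDiff_const.sub contDiff_id)) h2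
    have hmp := Measure.measurePreserving_sub_left (volume : Measure ℝ) β
    have hme := (Homeomorph.subLeft β).measurableEmbedding
    have hpre : (fun t => β - t) ⁻¹' Set.Ico (β - b) β = Set.Ioc 0 b := by
      ext t; simp
    have c1 := hmp.setLIntegral_comp_preimage_emb hme W (Set.Ico (β - b) β)
    have c2 := hmp.setLIntegral_comp_preimage_emb hme D (Set.Ico (β - b) β)
    rw [hpre] at c1 c2
    rw [← c1, ← c2]
    refine le_trans (le_of_eq ?_) (this.trans (le_of_eq ?_))
    · refine setLIntegral_congr_fun measurableSet_Ioc fun t ht => ?_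
      simp only [hW, hbi]
      have hle : (β - t - α)⁻¹ ≤ t⁻¹ := by
        have := ht.1
        have := ht.2
        exact inv_anti₀ ht.1 (by linarith)
      rw [sub_sub_cancel, max_eq_right hle]
    · refine lintegral_congr fun t => ?_
      simp only [hD]
      -- The reflection contributes a sign `(-1)^m`, which disappears on squaring.
      rw [iteratedDeriv_comp_const_sub]
      simp [mul_pow, ← pow_mul, mul_comm m 2]
  have hbα : β - b = α + b := by rw [hb]; ring
  rw [hbα] at right
  have hdisj : Disjoint (Set.Ioo α (α + b)) (Set.Ico (α + b) β) := by
    rw [Set.disjoint_left]; rintro t ⟨-, h⟩ ⟨h', -⟩; linarith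
  have hun : Set.Ioo α (α + b) ∪ Set.Ico (α + b) β = Set.Ioo α β :=
    Set.Ioo_union_Ico_eq_Ioo (by rw [hb]; linarith) (by rw [hb]; linarith)
  rw [← setLIntegral_congr Ioo_ae_eq_Ioc, ← setLIntegral_congr Ioo_ae_eq_Ioc] at left
  calc ∫⁻ t in Set.Ioo α β, W t
      = (∫⁻ t in Set.Ioo α (α + b), W t) + ∫⁻ t in Set.Ico (α + b) β, W t := by
        rw [← hun, lintegral_union measurableSet_Ico hdisj]
    _ ≤ (∫⁻ t in Set.Ioo α (α + b), D t) + ∫⁻ t in Set.Ico (α + b) β, D t := add_le_add left right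
    _ = ∫⁻ t in Set.Ioo α β, D t := by rw [← hun, lintegral_union measurableSet_Ico hdisj]
    _ ≤ ∫⁻ t, D t := setLIntegral_le_lintegral _ _

/-! ### Ray lengths in a bounded convex open set. -/

section Rays

variable {E : Type*} [NormedAddCommGroup E] [NormedSpace ℝ E]

/-- The distance from a point `x ∈ Ω` to the complement of `Ω` along the ray in direction `θ`,
measured in multiples of `θ`; it is `0` for `x ∉ Ω`. -/
noncomputable def rayLength (Ω : Set E) (x θ : E) : ℝ :=
  sSup {t : ℝ | x ∈ Ω ∧ x + t • θ ∈ Ω}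

variable {Ω : Set E}

lemma rayLength_of_notMem {x : E} (hx : x ∉ Ω) (θ : E) : rayLength Ω x θ = 0 := by
  simp [rayLength, hx]

lemma bddAbove_ray (hb : Bornology.IsBounded Ω) (x : E) {θ : E} (hθ : θ ≠ 0) :
    BddAbove {t : ℝ | x + t • θ ∈ Ω} := by
  obtain ⟨R, hR⟩ := hb.subset_closedBall x
  refine ⟨R / ‖θ‖, fun t ht => ?_⟩
  have := hR ht
  rw [mem_closedBall_iff_norm, add_sub_cancel_left, norm_smul] at this
  rw [le_div_iff₀ (norm_pos_iff.2 hθ)]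
  exact (mul_le_mul_of_nonneg_right (le_abs_self t) (norm_nonneg _)).trans this

/-- Openness prevents the supremum from being attained, which makes the inequality strict. With
`mem_of_lt_rayLength`, where convexity enters, it shows that the ray from `x` meets `Ω` exactly for
`0 ≤ t < rayLength Ω x θ`. -/
lemma lt_rayLength (ho : IsOpen Ω) (hb : Bornology.IsBounded Ω) {x θ : E} (hx : x ∈ Ω)
    (hθ : θ ≠ 0) {t : ℝ} (ht : x + t • θ ∈ Ω) : t < rayLength Ω x θ := by
  have ho' : IsOpen {t : ℝ | x + t • θ ∈ Ω} := ho.preimage (by fun_prop)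
  obtain ⟨δ, hδ, h⟩ := Metric.isOpen_iff.1 ho' t ht
  have hm : t + δ / 2 ∈ {t : ℝ | x ∈ Ω ∧ x + t • θ ∈ Ω} := by
    refine ⟨hx, h ?_⟩
    rw [Real.ball_eq_Ioo]
    constructor <;> linarith
  have : t + δ / 2 ≤ rayLength Ω x θ := by
    refine le_csSup ?_ hm
    simpa [hx] using bddAbove_ray hb x hθ
  linarith

lemma rayLength_pos (ho : IsOpen Ω) (hb : Bornology.IsBounded Ω) {x θ : E} (hx : x ∈ Ω)
    (hθ : θ ≠ 0) : 0 < rayLength Ω x θ :=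
  lt_rayLength ho hb hx hθ (by simpa using hx)

lemma mem_of_lt_rayLength (hc : Convex ℝ Ω) {x θ : E} (hx : x ∈ Ω) {t : ℝ} (ht0 : 0 ≤ t)
    (ht : t < rayLength Ω x θ) : x + t • θ ∈ Ω := by
  obtain ⟨s, ⟨-, hs⟩, hts⟩ := exists_lt_of_lt_csSup
    (s := {t : ℝ | x ∈ Ω ∧ x + t • θ ∈ Ω}) ⟨0, hx, by simpa using hx⟩ ht
  have hs0 : 0 < s := ht0.trans_lt hts
  have := hc.add_smul_sub_mem hx hs (t := t / s) ⟨by positivity, by rw [div_le_one hs0]; exact hts.le⟩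
  rwa [add_sub_cancel_left, smul_smul, div_mul_cancel₀ _ hs0.ne'] at this

/-- A line through a point of a bounded convex open set meets it in an interval. -/
lemma add_smul_mem_iff (ho : IsOpen Ω) (hc : Convex ℝ Ω) (hb : Bornology.IsBounded Ω) {x θ : E}
    (hx : x ∈ Ω) (hθ : θ ≠ 0) (t : ℝ) :
    x + t • θ ∈ Ω ↔ -rayLength Ω x (-θ) < t ∧ t < rayLength Ω x θ := by
  constructor
  · intro h
    refine ⟨?_, lt_rayLength ho hb hx hθ h⟩
    have := lt_rayLength ho hb hx (neg_ne_zero.2 hθ) (t := -t) (by simpa using h)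
    linarith
  · rintro ⟨h1, h2⟩
    rcases le_total 0 t with h | h
    · exact mem_of_lt_rayLength hc hx h h2
    · simpa using mem_of_lt_rayLength hc hx (θ := -θ) (t := -t) (by linarith) (by linarith)

lemma rayLength_add_smul (ho : IsOpen Ω) (hc : Convex ℝ Ω) (hb : Bornology.IsBounded Ω) {x θ : E}
    (hx : x ∈ Ω) (hθ : θ ≠ 0) {t : ℝ} (ht : x + t • θ ∈ Ω) :
    rayLength Ω (x + t • θ) θ = rayLength Ω x θ - t := by
  have h := add_smul_mem_iff ho hc hb hx hθ
  have : {s : ℝ | x + t • θ ∈ Ω ∧ x + t • θ + s • θ ∈ Ω} =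
      Set.Ioo (-rayLength Ω x (-θ) - t) (rayLength Ω x θ - t) := by
    ext s
    rw [Set.mem_ofPred_eq, and_iff_right ht, add_assoc, ← add_smul, h, Set.mem_Ioo]
    constructor <;> rintro ⟨h1, h2⟩ <;> constructor <;> linarith
  rw [rayLength, this, csSup_Ioo]
  have := (h t).1 ht
  linarith

/-- For `t ≥ 0` the superlevel set is the open set of pairs with `x` and `x + tθ` both in `Ω`; for
`t < 0` it is everything. Directions must avoid `0`, where the ray is unbounded. -/
lemma measurable_rayLength [MeasurableSpace E] [BorelSpace E] [SecondCountableTopology E]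
    (ho : IsOpen Ω) (hc : Convex ℝ Ω)
    (hb : Bornology.IsBounded Ω) {S : Set E} (hS : (0 : E) ∉ S) :
    Measurable fun p : E × S => rayLength Ω p.1 p.2 := by
  refine measurable_of_Ioi fun t => ?_
  rcases lt_or_ge t 0 with ht | ht
  · convert MeasurableSet.univ
    ext p
    have hp : (p.2 : E) ≠ 0 := fun h => hS (h ▸ p.2.2)
    simp only [Set.mem_preimage, Set.mem_Ioi, Set.mem_univ, iff_true]
    by_cases hx : p.1 ∈ Ω
    · exact ht.trans (rayLength_pos ho hb hx hp)
    · rwa [rayLength_of_notMem hx]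
  · have : (fun p : E × S => rayLength Ω p.1 p.2) ⁻¹' Set.Ioi t =
        {p | p.1 ∈ Ω} ∩ {p | p.1 + t • (p.2 : E) ∈ Ω} := by
      ext p
      have hp : (p.2 : E) ≠ 0 := fun h => hS (h ▸ p.2.2)
      simp only [Set.mem_preimage, Set.mem_Ioi, Set.mem_inter_iff, Set.mem_ofPred_eq]
      by_cases hx : p.1 ∈ Ω
      · exact ⟨fun h => ⟨hx, mem_of_lt_rayLength hc hx ht h⟩,
          fun h => lt_rayLength ho hb hx hp h.2⟩
      · simp [rayLength_of_notMem hx, hx, ht]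
    rw [this]
    exact ((ho.preimage continuous_fst).inter (ho.preimage (by fun_prop))).measurableSet

/-- The weight of the Hardy–Rellich inequality of order `m` along the direction `θ`. -/
noncomputable def rayWeight (m : ℕ) (Ω : Set E) (x θ : E) : ℝ :=
  constA m * max (rayLength Ω x (-θ))⁻¹ (rayLength Ω x θ)⁻¹ ^ (2 * m) +
    remainderConst m * (2 / (rayLength Ω x θ + rayLength Ω x (-θ))) ^ (2 * m)

lemma measurable_rayLength_neg [MeasurableSpace E] [BorelSpace E] [SecondCountableTopology E]
    (ho : IsOpen Ω) (hc : Convex ℝ Ω) (hb : Bornology.IsBounded Ω) :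
    Measurable fun p : E × Metric.sphere (0 : E) 1 => rayLength Ω p.1 (-(p.2 : E)) :=
  (measurable_rayLength ho hc hb (S := Metric.sphere (0 : E) 1) (by simp)).comp
    (f := fun p : E × Metric.sphere (0 : E) 1 => (p.1, -p.2)) (by fun_prop)

lemma measurable_rayWeight [MeasurableSpace E] [BorelSpace E] [SecondCountableTopology E]
    (m : ℕ) (ho : IsOpen Ω) (hc : Convex ℝ Ω) (hb : Bornology.IsBounded Ω) :
    Measurable fun p : E × Metric.sphere (0 : E) 1 => rayWeight m Ω p.1 p.2 := by
  have h1 := measurable_rayLength ho hc hb (S := Metric.sphere (0 : E) 1) (by simp)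
  have h2 := measurable_rayLength_neg ho hc hb
  unfold rayWeight
  fun_prop

end Rays

/-! ### Fubini along parallel lines. -/

section Slicing

variable {E : Type*} [NormedAddCommGroup E] [InnerProductSpace ℝ E] [MeasurableSpace E]
  [BorelSpace E] [SecondCountableTopology E]

/-- Integration along lines in direction `θ`, the lines being parametrised by a slab that each of
them meets in a segment of length one. -/
lemma lintegral_eq_lintegral_slab (μ : Measure E) [μ.IsAddRightInvariant] [SFinite μ]
    {F : E → ENNReal} (hF : Measurable F) {θ : E} (hθ : ‖θ‖ = 1) :
    ∫⁻ x, F x ∂μ = ∫⁻ x in {x | inner ℝ θ x ∈ Set.Ico (0 : ℝ) 1}, (∫⁻ t : ℝ, F (x + t • θ)) ∂μ := by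
  set Q : Set E := {x | inner ℝ θ x ∈ Set.Ico (0 : ℝ) 1} with hQ
  have hQm : MeasurableSet Q := by
    have : Measurable fun x : E => (inner ℝ θ x : ℝ) := by fun_prop
    exact this measurableSet_Ico
  have hJ : Measurable fun p : E × ℝ => Q.indicator (fun _ => (1 : ENNReal)) p.1 * F (p.1 + p.2 • θ) :=
    ((measurable_const.indicator hQm).comp measurable_fst).mul (hF.comp (by fun_prop))
  have hJ' : Measurable fun p : E × ℝ => Q.indicator (fun _ => (1 : ENNReal)) (p.1 - p.2 • θ) * F p.1 :=
    ((measurable_const.indicator hQm).comp (by fun_prop)).mul (hF.comp measurable_fst)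
  -- Inserting the indicator of the slab, exchanging integrals and translating by `tθ` moves the
  -- `t`-dependence onto the indicator. No splitting of the measure along `θ` and its orthogonal
  -- complement is needed.
  symm
  calc ∫⁻ x in Q, (∫⁻ t : ℝ, F (x + t • θ)) ∂μ
      = ∫⁻ x, (∫⁻ t : ℝ, Q.indicator (fun _ => (1 : ENNReal)) x * F (x + t • θ)) ∂μ := by
        rw [← lintegral_indicator hQm]
        refine lintegral_congr fun x => ?_
        by_cases hx : x ∈ Q <;> simp [hx]
    _ = ∫⁻ t : ℝ, ∫⁻ x, Q.indicator (fun _ => (1 : ENNReal)) x * F (x + t • θ) ∂μ :=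
        lintegral_lintegral_swap hJ.aemeasurable
    _ = ∫⁻ t : ℝ, ∫⁻ x, Q.indicator (fun _ => (1 : ENNReal)) (x - t • θ) * F x ∂μ := by
        refine lintegral_congr fun t => ?_
        rw [← lintegral_add_right_eq_self
          (fun x => Q.indicator (fun _ => (1 : ENNReal)) (x - t • θ) * F x) (t • θ)]
        simp only [add_sub_cancel_right]
    _ = ∫⁻ x, (∫⁻ t : ℝ, Q.indicator (fun _ => (1 : ENNReal)) (x - t • θ) * F x) ∂μ :=
        (lintegral_lintegral_swap hJ'.aemeasurable).symm
    _ = ∫⁻ x, F x ∂μ := by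
        refine lintegral_congr fun x => ?_
        have hI : Measurable fun t : ℝ => Q.indicator (fun _ => (1 : ENNReal)) (x - t • θ) :=
          (measurable_const.indicator hQm).comp (by fun_prop)
        rw [lintegral_mul_const _ hI]
        -- As `‖θ‖ = 1` and the slab has width one, the admissible `t` form an interval of length
        -- one.
        have : (fun t : ℝ => Q.indicator (fun _ => (1 : ENNReal)) (x - t • θ)) =
            (Set.Ioc (inner ℝ θ x - 1) (inner ℝ θ x)).indicator fun _ => 1 := by
          ext t
          have : x - t • θ ∈ Q ↔ t ∈ Set.Ioc (inner ℝ θ x - 1) (inner ℝ θ x) := by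
            simp only [hQ, Set.mem_ofPred_eq, Set.mem_Ico, Set.mem_Ioc, inner_sub_right,
              inner_smul_right, real_inner_self_eq_norm_sq, hθ]
            constructor <;> rintro ⟨h1, h2⟩ <;> constructor <;> linarith
          simp [Set.indicator, this]
        rw [this, lintegral_indicator measurableSet_Ioc]
        simp

end Slicing

/-! ### The inequality in a single direction. -/

section Directional

open SchwartzMap LineDeriv

lemma iteratedDeriv_comp_line {E : Type*} [NormedAddCommGroup E] [NormedSpace ℝ E] (m : ℕ)
    (U : 𝓢(E, ℝ)) (x θ : E) (t : ℝ) :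
    iteratedDeriv m (fun s : ℝ => U (x + s • θ)) t = (∂_{θ}^[m] U) (x + t • θ) := by
  induction m generalizing U with
  | zero => simp
  | succ m ih =>
    have : deriv (fun s : ℝ => U (x + s • θ)) = fun s => (∂_{θ} U) (x + s • θ) := by
      ext s
      have h1 : HasDerivAt (fun s : ℝ => x + s • θ) θ s := by
        simpa using ((hasDerivAt_id s).smul_const θ).const_add x
      exact ((U.hasFDerivAt (x + s • θ)).comp_hasDerivAt s h1).deriv
    rw [iteratedDeriv_succ', this, ih, Function.iterate_succ_apply]

/-- The Hardy–Rellich inequality for derivatives in a single direction. -/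
lemma lintegral_rayWeight_le {E : Type*} [NormedAddCommGroup E] [InnerProductSpace ℝ E]
    [MeasurableSpace E] [BorelSpace E] [SecondCountableTopology E] (μ : Measure E)
    [μ.IsAddRightInvariant] [SFinite μ] (m : ℕ) {Ω : Set E} (ho : IsOpen Ω)
    (hc : Convex ℝ Ω) (hb : Bornology.IsBounded Ω) (U : 𝓢(E, ℝ)) (hU : tsupport U ⊆ Ω) {θ : E}
    (hθ : ‖θ‖ = 1) :
    ∫⁻ x in Ω, ENNReal.ofReal (U x ^ 2 * rayWeight m Ω x θ) ∂μ ≤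
      ∫⁻ x, ENNReal.ofReal ((∂_{θ}^[m] U) x ^ 2) ∂μ := by
  have hθ0 : θ ≠ 0 := by rintro rfl; simp at hθ
  have hW : Measurable fun x => rayWeight m Ω x θ :=
    (measurable_rayWeight m ho hc hb).comp
      (f := fun x : E => (x, (⟨θ, by simpa using hθ⟩ : Metric.sphere (0 : E) 1))) (by fun_prop)
  have hUc : Continuous U := U.continuous
  have hm1 : Measurable (Ω.indicator fun x => ENNReal.ofReal (U x ^ 2 * rayWeight m Ω x θ)) :=
    (by fun_prop : Measurable _).indicator ho.measurableSet
  have hDc : Continuous ⇑(∂_{θ}^[m] U) := (∂_{θ}^[m] U).continuous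
  have hm2 : Measurable fun x => ENNReal.ofReal ((∂_{θ}^[m] U) x ^ 2) := by fun_prop
  rw [← lintegral_indicator ho.measurableSet, lintegral_eq_lintegral_slab μ hm1 hθ,
    lintegral_eq_lintegral_slab μ hm2 hθ]
  refine lintegral_mono fun x => ?_
  by_cases hx : ∃ t₀ : ℝ, x + t₀ • θ ∈ Ω
  · obtain ⟨t₀, hy⟩ := hx
    -- The line is reparametrised from a point of `Ω`, so that its trace on `Ω` is the interval `(α,
    -- β)` of ray lengths.
    set y := x + t₀ • θ with hyd
    have hline : ∀ t : ℝ, x + (t + t₀) • θ = y + t • θ := by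
      intro t; rw [hyd, add_smul]; abel
    rw [← lintegral_add_right_eq_self (μ := volume) (fun t : ℝ => Ω.indicator _ (x + t • θ)) t₀,
      ← lintegral_add_right_eq_self (μ := volume)
        (fun t : ℝ => ENNReal.ofReal ((∂_{θ}^[m] U) (x + t • θ) ^ 2)) t₀]
    simp only [hline]
    have hmem := add_smul_mem_iff ho hc hb hy hθ0
    set α := -rayLength Ω y (-θ) with hα
    set β := rayLength Ω y θ with hβ
    set f : ℝ → ℝ := fun t => U (y + t • θ) with hf
    have hsupp : tsupport f ⊆ Set.Ioo α β := by
      refine (tsupport_comp_subset_preimage U (f := fun t : ℝ => y + t • θ)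
        (by fun_prop)).trans fun t ht => ?_
      exact (hmem t).1 (hU ht)
    have hcomp : HasCompactSupport f :=
      HasCompactSupport.of_support_subset_isCompact isCompact_Icc
        ((subset_tsupport f).trans (hsupp.trans Set.Ioo_subset_Icc_self))
    have hfs : ContDiff ℝ ∞ f := (U.smooth ⊤).comp (by fun_prop)
    have key := lintegral_hardyRellich_interval m hfs hcomp hsupp
    simp only [hf, iteratedDeriv_comp_line] at key
    refine le_trans (le_of_eq ?_) key
    rw [← lintegral_indicator measurableSet_Ioo]
    refine lintegral_congr fun t => ?_
    by_cases ht : y + t • θ ∈ Ω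
    · have ht' : t ∈ Set.Ioo α β := (hmem t).1 ht
      -- At `y + tθ` the two ray lengths are `t - α` and `β - t`, so `rayWeight` is exactly the
      -- one-dimensional weight.
      rw [Set.indicator_of_mem ht, Set.indicator_of_mem ht', rayWeight,
        rayLength_add_smul ho hc hb hy hθ0 ht]
      have e : rayLength Ω (y + t • θ) (-θ) = rayLength Ω y (-θ) + t := by
        have := rayLength_add_smul ho hc hb hy (neg_ne_zero.2 hθ0) (t := -t) (by simpa using ht)
        simpa using this
      rw [e, ← hβ, show rayLength Ω y (-θ) = -α by simp [hα]]
      ring_nf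
    · have ht' : t ∉ Set.Ioo α β := fun h => ht ((hmem t).2 h)
      rw [Set.indicator_of_notMem ht, Set.indicator_of_notMem ht']
  · have hx' : ∀ t : ℝ, x + t • θ ∉ Ω := fun t h => hx ⟨t, h⟩
    simp [hx']

end Directional

/-! ### Polar coordinates for lower integrals. -/

section Polar

variable {E : Type*} [NormedAddCommGroup E] [NormedSpace ℝ E] [FiniteDimensional ℝ E]
  [MeasurableSpace E] [BorelSpace E]

lemma lintegral_volumeIoiPow (n : ℕ) {f : ℝ → ENNReal} (hf : Measurable f) :
    ∫⁻ t : Set.Ioi (0 : ℝ), f t ∂(Measure.volumeIoiPow n) =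
      ∫⁻ t in Set.Ioi (0 : ℝ), ENNReal.ofReal (t ^ n) * f t := by
  rw [Measure.volumeIoiPow, lintegral_withDensity_eq_lintegral_mul _ (by fun_prop) (by fun_prop)]
  exact lintegral_subtype_comap (μ := volume) measurableSet_Ioi
    (fun t : ℝ => ENNReal.ofReal (t ^ n) * f t)

/-- Integration in polar coordinates. -/
lemma lintegral_polar [Nontrivial E] (μ : Measure E) [μ.IsAddHaarMeasure] {F : E → ENNReal}
    (hF : Measurable F) :
    ∫⁻ x, F x ∂μ = ∫⁻ θ : Metric.sphere (0 : E) 1, (∫⁻ t in Set.Ioi (0 : ℝ),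
      ENNReal.ofReal (t ^ (Module.finrank ℝ E - 1)) * F (t • (θ : E))) ∂μ.toSphere := by
  have h1 : ∫⁻ x, F x ∂μ = ∫⁻ x : ({0}ᶜ : Set E), F x ∂(μ.comap (↑)) := by
    rw [lintegral_subtype_comap (measurableSet_singleton _).compl, restrict_compl_singleton]
  have hmp := μ.measurePreserving_homeomorphUnitSphereProd
  have h2 : ∫⁻ x : ({0}ᶜ : Set E), F x ∂(μ.comap (↑)) =
      ∫⁻ p : Metric.sphere (0 : E) 1 × Set.Ioi (0 : ℝ), F ((p.2 : ℝ) • (p.1 : E))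
        ∂(μ.toSphere.prod (Measure.volumeIoiPow (Module.finrank ℝ E - 1))) := by
    rw [← hmp.lintegral_comp (by fun_prop)]
    refine lintegral_congr fun x => ?_
    have := (homeomorphUnitSphereProd E).symm_apply_apply x
    conv_lhs => rw [← this]
    rfl
  rw [h1, h2, lintegral_prod _ (by fun_prop)]
  refine lintegral_congr fun θ => ?_
  exact lintegral_volumeIoiPow _ (f := fun t => F (t • (θ : E))) (by fun_prop)

end Polar

/-! ### Moments of the one-dimensional Gaussian. -/

section GaussianMoments

/-- The half-line Gaussian moment `∫_0^∞ t^n e^{-t²/2} dt`. -/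
noncomputable def halfGaussianMoment (n : ℕ) : ENNReal :=
  ∫⁻ t in Set.Ioi (0 : ℝ), ENNReal.ofReal (t ^ n * Real.exp (-t ^ 2 / 2))

lemma halfGaussianMoment_eq (n : ℕ) : halfGaussianMoment n =
    ENNReal.ofReal ((1 / 2 : ℝ) ^ (-((n : ℝ) + 1) / 2) * (1 / 2) * Real.Gamma (((n : ℝ) + 1) / 2)) := by
  have hn : (-1 : ℝ) < n := lt_of_lt_of_le (by norm_num) (Nat.cast_nonneg n)
  have h1 := integral_rpow_mul_exp_neg_mul_rpow (p := 2) (q := n) (b := 1 / 2) (by norm_num) hn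
    (by norm_num)
  have h2 := integrableOn_rpow_mul_exp_neg_mul_rpow (p := 2) (s := n) (b := 1 / 2) hn (by norm_num)
    (by norm_num)
  rw [← h1, ofReal_integral_eq_lintegral_ofReal h2]
  · refine setLIntegral_congr_fun measurableSet_Ioi fun t _ => ?_
    simp only [Real.rpow_natCast, Real.rpow_ofNat]
    ring_nf
  · refine (ae_restrict_iff' measurableSet_Ioi).2 (Filter.Eventually.of_forall fun t ht => ?_)
    have : (0 : ℝ) < t := ht
    positivity

lemma halfGaussianMoment_ne_top (n : ℕ) : halfGaussianMoment n ≠ ⊤ := by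
  rw [halfGaussianMoment_eq]; exact ENNReal.ofReal_ne_top

lemma halfGaussianMoment_ne_zero (n : ℕ) : halfGaussianMoment n ≠ 0 := by
  rw [halfGaussianMoment_eq, Ne, ENNReal.ofReal_eq_zero, not_le]
  have := Real.Gamma_pos_of_pos (show 0 < ((n : ℝ) + 1) / 2 by positivity)
  positivity

lemma halfGaussianMoment_add_two (n : ℕ) :
    halfGaussianMoment (n + 2) = ENNReal.ofReal (n + 1) * halfGaussianMoment n := by
  rw [halfGaussianMoment_eq, halfGaussianMoment_eq, ← ENNReal.ofReal_mul (by positivity)]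
  congr 1
  have e1 : (((n + 2 : ℕ) : ℝ) + 1) / 2 = ((n : ℝ) + 1) / 2 + 1 := by push_cast; ring
  have e2 : -(((n + 2 : ℕ) : ℝ) + 1) / 2 = -((n : ℝ) + 1) / 2 + (-1) := by push_cast; ring
  rw [e1, e2, Real.Gamma_add_one (by positivity), Real.rpow_add (by norm_num), Real.rpow_neg_one]
  ring

/-- The factors are arranged so that `n = dim - 1` yields `N(N+2)⋯(N+2k-2)` and `n = 0` yields
`1·3⋯(2k-1)`, the two products in `Γ(m)`. -/
lemma halfGaussianMoment_add_two_mul (n k : ℕ) :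
    halfGaussianMoment (n + 2 * k) =
      ENNReal.ofReal (∏ j ∈ Finset.Icc 1 k, ((n : ℝ) + 1 + 2 * (j : ℝ) - 2)) *
        halfGaussianMoment n := by
  have hnn : ∀ k : ℕ, 0 ≤ ∏ j ∈ Finset.Icc 1 k, ((n : ℝ) + 1 + 2 * (j : ℝ) - 2) := by
    refine fun k => Finset.prod_nonneg fun j hj => ?_
    have : (1 : ℝ) ≤ j := by exact_mod_cast (Finset.mem_Icc.1 hj).1
    have := Nat.cast_nonneg (α := ℝ) n
    linarith
  induction k with
  | zero => simp
  | succ k ih =>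
    rw [show n + 2 * (k + 1) = (n + 2 * k) + 2 by ring, halfGaussianMoment_add_two, ih,
      Finset.prod_Icc_succ_top (by omega), ENNReal.ofReal_mul (hnn k), ← mul_assoc,
      mul_comm (ENNReal.ofReal (_ + 1))]
    congr 3
    push_cast
    ring

lemma lintegral_even_moment (k : ℕ) :
    ∫⁻ t : ℝ, ENNReal.ofReal (t ^ (2 * k) * Real.exp (-t ^ 2 / 2)) =
      2 * halfGaussianMoment (2 * k) := by
  set f : ℝ → ENNReal := fun t => ENNReal.ofReal (t ^ (2 * k) * Real.exp (-t ^ 2 / 2)) with hf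
  have hneg : ∫⁻ t in Set.Iic (0 : ℝ), f t = halfGaussianMoment (2 * k) := by
    have h := (Measure.measurePreserving_neg (volume : Measure ℝ)).setLIntegral_comp_preimage_emb
      (Homeomorph.neg ℝ).measurableEmbedding f (Set.Iic 0)
    rw [← h, show (Neg.neg : ℝ → ℝ) ⁻¹' Set.Iic 0 = Set.Ici 0 by ext; simp,
      ← setLIntegral_congr Ioi_ae_eq_Ici, halfGaussianMoment]
    refine lintegral_congr fun t => ?_
    simp [hf, (even_two_mul k).neg_pow]
  rw [← lintegral_add_compl f (measurableSet_Iic (a := (0 : ℝ))), hneg, Set.compl_Iic,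
    two_mul (halfGaussianMoment _)]
  rfl

end GaussianMoments

/-! ### Even moments of a linear form on the sphere, from two evaluations of one Gaussian integral.
-/

section SphereMoments

variable {E : Type*} [NormedAddCommGroup E] [InnerProductSpace ℝ E] [FiniteDimensional ℝ E]
  [MeasurableSpace E] [BorelSpace E]

lemma lintegral_gaussian_polar [Nontrivial E] (μ : Measure E) [μ.IsAddHaarMeasure] (k : ℕ)
    (ξ : E) :
    ∫⁻ x, ENNReal.ofReal (inner ℝ ξ x ^ (2 * k) * Real.exp (-‖x‖ ^ 2 / 2)) ∂μ =
      (∫⁻ θ : Metric.sphere (0 : E) 1, ENNReal.ofReal (inner ℝ ξ (θ : E) ^ (2 * k)) ∂μ.toSphere) *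
        halfGaussianMoment (Module.finrank ℝ E - 1 + 2 * k) := by
  rw [lintegral_polar μ (by fun_prop), ← lintegral_mul_const _ (by fun_prop)]
  refine lintegral_congr fun θ => ?_
  rw [halfGaussianMoment, ← lintegral_const_mul _ (by fun_prop)]
  refine setLIntegral_congr_fun measurableSet_Ioi fun t ht => ?_
  have ht0 : (0 : ℝ) < t := ht
  have hθ : ‖(θ : E)‖ = 1 := by simp
  rw [← ENNReal.ofReal_mul (by positivity), ← ENNReal.ofReal_mul ((even_two_mul k).pow_nonneg _),
    norm_smul, hθ, inner_smul_right, mul_one, Real.norm_eq_abs, sq_abs]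
  congr 1
  ring

/-- Along lines parallel to the unit vector `ξ` the Gaussian factorises, since `‖x‖² - ⟨ξ,x⟩²` is
constant on them. The transverse factor does not depend on `k`. -/
lemma lintegral_gaussian_slab (μ : Measure E) [μ.IsAddHaarMeasure] (k : ℕ)
    {ξ : E} (hξ : ‖ξ‖ = 1) :
    ∫⁻ x, ENNReal.ofReal (inner ℝ ξ x ^ (2 * k) * Real.exp (-‖x‖ ^ 2 / 2)) ∂μ =
      (∫⁻ x in {x | inner ℝ ξ x ∈ Set.Ico (0 : ℝ) 1},
        ENNReal.ofReal (Real.exp (-(‖x‖ ^ 2 - inner ℝ ξ x ^ 2) / 2)) ∂μ) *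
        (2 * halfGaussianMoment (2 * k)) := by
  rw [lintegral_eq_lintegral_slab μ (by fun_prop) hξ, ← lintegral_mul_const _ (by fun_prop)]
  refine lintegral_congr fun x => ?_
  rw [← lintegral_even_moment, ← lintegral_const_mul _ (by fun_prop),
    ← lintegral_add_right_eq_self _ (-inner ℝ ξ x)]
  refine lintegral_congr fun t => ?_
  rw [← ENNReal.ofReal_mul (by positivity)]
  congr 1
  rw [inner_add_right, inner_smul_right, real_inner_self_eq_norm_sq, hξ, norm_add_sq_real,
    inner_smul_right, norm_smul, hξ, real_inner_comm x ξ, mul_left_comm (Real.exp _), ← Real.exp_add,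
    Real.norm_eq_abs, mul_one, sq_abs]
  ring_nf

/-- The even moments of a linear functional on the unit sphere. -/
lemma lintegral_sphere_inner_pow [Nontrivial E] (μ : Measure E) [μ.IsAddHaarMeasure] (k : ℕ)
    (ξ : E) :
    (∫⁻ θ : Metric.sphere (0 : E) 1, ENNReal.ofReal (inner ℝ ξ (θ : E) ^ (2 * k)) ∂μ.toSphere) *
        ENNReal.ofReal (∏ j ∈ Finset.Icc 1 k, ((Module.finrank ℝ E : ℝ) + 2 * (j : ℝ) - 2)) =
      ENNReal.ofReal (‖ξ‖ ^ (2 * k)) * (μ.toSphere Set.univ *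
        ENNReal.ofReal (∏ j ∈ Finset.Icc 1 k, (2 * (j : ℝ) - 1))) := by
  have unit : ∀ ξ : E, ‖ξ‖ = 1 →
      (∫⁻ θ : Metric.sphere (0 : E) 1, ENNReal.ofReal (inner ℝ ξ (θ : E) ^ (2 * k)) ∂μ.toSphere) *
        ENNReal.ofReal (∏ j ∈ Finset.Icc 1 k, ((Module.finrank ℝ E : ℝ) + 2 * (j : ℝ) - 2)) =
      μ.toSphere Set.univ * ENNReal.ofReal (∏ j ∈ Finset.Icc 1 k, (2 * (j : ℝ) - 1)) := by
    intro ξ hξ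
    -- The polar and the sliced evaluation are equated for `k` and for `0`; the case `0` eliminates
    -- the unknown transverse factor.
    have h1 := (lintegral_gaussian_polar μ k ξ).symm.trans (lintegral_gaussian_slab μ k hξ)
    have h0 := (lintegral_gaussian_polar μ 0 ξ).symm.trans (lintegral_gaussian_slab μ 0 hξ)
    simp only [mul_zero, pow_zero, ENNReal.ofReal_one, lintegral_one, add_zero] at h0
    rw [halfGaussianMoment_add_two_mul] at h1
    have e := halfGaussianMoment_add_two_mul 0 k
    rw [zero_add] at e
    rw [e, mul_left_comm 2, mul_left_comm (∫⁻ _ in _, _ ∂μ), ← h0] at h1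
    have hd : ((Module.finrank ℝ E - 1 : ℕ) : ℝ) + 1 = Module.finrank ℝ E := by
      have := Module.finrank_pos (R := ℝ) (M := E)
      push_cast [this]; ring
    rw [hd] at h1
    have e3 : ∀ j : ℕ, ((0 : ℕ) : ℝ) + 1 + 2 * (j : ℝ) - 2 = 2 * (j : ℝ) - 1 := by
      intro j; push_cast; ring
    simp only [e3] at h1
    refine (ENNReal.mul_left_inj (halfGaussianMoment_ne_zero (Module.finrank ℝ E - 1))
      (halfGaussianMoment_ne_top _)).1 ?_
    rw [mul_assoc, h1]
    ring
  rcases eq_or_ne ξ 0 with rfl | hξ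
  · rcases Nat.eq_zero_or_pos k with rfl | hk
    · simp
    · have : 2 * k ≠ 0 := by omega
      simp [this]
  · have hn : ‖ξ‖ ≠ 0 := norm_ne_zero_iff.2 hξ
    rw [← unit (‖ξ‖⁻¹ • ξ) (by rw [norm_smul, norm_inv, norm_norm, inv_mul_cancel₀ hn]), ← mul_assoc,
      ← lintegral_const_mul _ (by fun_prop)]
    congr 1
    refine lintegral_congr fun θ => ?_
    rw [← ENNReal.ofReal_mul (by positivity), ← mul_pow, inner_smul_left]
    congr 2
    simp only [map_inv₀, conj_trivial]
    field_simp

end SphereMoments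

/-! ### Mean of inverse powers of the half chord. -/

section MeanChord

variable {E : Type*} [NormedAddCommGroup E] [NormedSpace ℝ E] [FiniteDimensional ℝ E]
  [MeasurableSpace E] [BorelSpace E]

/-- The volume of a convex body in polar coordinates about one of its points. -/
lemma lintegral_rayLength_pow [Nontrivial E] (μ : Measure E) [μ.IsAddHaarMeasure] {Ω : Set E}
    (ho : IsOpen Ω) (hc : Convex ℝ Ω) (hb : Bornology.IsBounded Ω) {x : E} (hx : x ∈ Ω) (ε : ℝ)
    (hε : ε = 1 ∨ ε = -1) :
    ∫⁻ θ : Metric.sphere (0 : E) 1,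
      ENNReal.ofReal (rayLength Ω x (ε • (θ : E)) ^ Module.finrank ℝ E) ∂μ.toSphere =
        ENNReal.ofReal (Module.finrank ℝ E) * μ Ω := by
  have hε0 : ε ≠ 0 := by rcases hε with rfl | rfl <;> norm_num
  set d := Module.finrank ℝ E with hd
  have hdpos : 0 < d := Module.finrank_pos
  -- The sign `ε` is absorbed by invariance of `μ` under `y ↦ x ± y`, so antipodal invariance of the
  -- sphere measure is not needed.
  have hΩ : μ Ω = ∫⁻ y, Ω.indicator (fun _ => (1 : ENNReal)) (x + ε • y) ∂μ := by
    rcases hε with rfl | rfl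
    · simp only [one_smul]
      rw [lintegral_add_left_eq_self (Ω.indicator fun _ => (1 : ENNReal)) x,
        lintegral_indicator ho.measurableSet]
      simp
    · simp only [neg_smul, one_smul, ← sub_eq_add_neg]
      rw [lintegral_sub_left_eq_self (Ω.indicator fun _ => (1 : ENNReal)) x,
        lintegral_indicator ho.measurableSet]
      simp
  have hmeas : Measurable fun y : E => Ω.indicator (fun _ => (1 : ENNReal)) (x + ε • y) :=
    (measurable_const.indicator ho.measurableSet).comp (by fun_prop)
  rw [hΩ, lintegral_polar μ hmeas, ← lintegral_const_mul' _ _ ENNReal.ofReal_ne_top]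
  refine lintegral_congr fun θ => ?_
  have hθ : ε • (θ : E) ≠ 0 := by
    refine smul_ne_zero hε0 fun h => ?_
    have := θ.2
    simp [h] at this
  set r := rayLength Ω x (ε • (θ : E)) with hr
  have hrpos : 0 < r := rayLength_pos ho hb hx hθ
  have hin : ∫⁻ t in Set.Ioi (0 : ℝ), ENNReal.ofReal (t ^ (d - 1)) *
      Ω.indicator (fun _ => (1 : ENNReal)) (x + ε • t • (θ : E)) =
      ∫⁻ t in Set.Ioo 0 r, ENNReal.ofReal (t ^ (d - 1)) := by
    rw [← lintegral_indicator measurableSet_Ioi, ← lintegral_indicator measurableSet_Ioo]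
    refine lintegral_congr fun t => ?_
    by_cases ht : 0 < t
    · have hiff : x + ε • t • (θ : E) ∈ Ω ↔ t < r := by
        rw [smul_comm]
        exact ⟨lt_rayLength ho hb hx hθ, mem_of_lt_rayLength hc hx ht.le⟩
      by_cases htr : t < r
      · simp [Set.indicator, ht, htr, hiff.2 htr]
      · simp [Set.indicator, ht, htr, hiff]
    · simp [Set.indicator, ht]
  rw [hin, setLIntegral_congr Ioo_ae_eq_Ioc,
    ← ofReal_integral_eq_lintegral_ofReal (intervalIntegral.intervalIntegrable_pow _).1,
    ← intervalIntegral.integral_of_le hrpos.le, ← ENNReal.ofReal_mul (by positivity)]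
  · congr 1
    have : ((d - 1 : ℕ) : ℝ) + 1 = d := by push_cast [hdpos]; ring
    rw [integral_pow, this, Nat.sub_add_cancel hdpos, zero_pow hdpos.ne']
    field_simp
    simp
  · refine (ae_restrict_iff' measurableSet_Ioc).2 (Filter.Eventually.of_forall fun t ht => ?_)
    have : (0 : ℝ) < t := ht.1
    positivity

/-- With `y = e^l`, the bound `1 + z ≤ e^z` is applied to both powers, and the terms linear in `l`
cancel. Integrated over the sphere, this replaces Jensen's inequality; equality at `y = 1`
corresponds to the ball. -/
lemma add_le_weighted_pow (d m : ℕ) {y : ℝ} (hy : 0 < y) :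
    (d : ℝ) + 2 * m ≤ d * y⁻¹ ^ (2 * m) + 2 * m * y ^ d := by
  obtain ⟨l, rfl⟩ : ∃ l, y = Real.exp l := ⟨Real.log y, (Real.exp_log hy).symm⟩
  rw [← Real.exp_neg, ← Real.exp_nat_mul, ← Real.exp_nat_mul]
  have h1 := mul_le_mul_of_nonneg_left (Real.add_one_le_exp (((2 * m : ℕ) : ℝ) * -l))
    (Nat.cast_nonneg (α := ℝ) d)
  have h2 := mul_le_mul_of_nonneg_left (Real.add_one_le_exp ((d : ℝ) * l))
    (by positivity : (0 : ℝ) ≤ 2 * m)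
  push_cast at h1 ⊢
  linarith

/-- The mean over all directions of the `-2m`-th power of the half chord through a point is at
least its value for the ball of the same volume. -/
lemma le_lintegral_half_chord [Nontrivial E] (μ : Measure E) [μ.IsAddHaarMeasure] (m : ℕ)
    {Ω : Set E} (ho : IsOpen Ω) (hc : Convex ℝ Ω) (hb : Bornology.IsBounded Ω) {x : E}
    (hx : x ∈ Ω) :
    μ.toSphere Set.univ * ENNReal.ofReal
      (μ.real (Metric.ball (0 : E) 1) ^ (2 * (m : ℝ) / (Module.finrank ℝ E : ℝ)) *
        μ.real Ω ^ (-(2 * (m : ℝ)) / (Module.finrank ℝ E : ℝ))) ≤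
    ∫⁻ θ : Metric.sphere (0 : E) 1, ENNReal.ofReal
      ((2 / (rayLength Ω x θ + rayLength Ω x (-(θ : E)))) ^ (2 * m)) ∂μ.toSphere := by
  set d := Module.finrank ℝ E with hd
  have hdpos : 0 < d := Module.finrank_pos
  have hdr : (0 : ℝ) < d := by exact_mod_cast hdpos
  set V := μ.real Ω with hV
  set a := μ.real (Metric.ball (0 : E) 1) with ha
  have hVpos : 0 < V := ENNReal.toReal_pos (ho.measure_pos μ ⟨x, hx⟩).ne' hb.measure_lt_top.ne
  have hapos : 0 < a := ENNReal.toReal_pos (Metric.measure_ball_pos μ _ one_pos).ne'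
    measure_ball_lt_top.ne
  have hσ : μ.toSphere Set.univ = ENNReal.ofReal (d * a) := by
    rw [Measure.toSphere_apply_univ, ENNReal.ofReal_mul hdr.le, ha, ofReal_measureReal
      measure_ball_lt_top.ne, ENNReal.ofReal_natCast]
  -- The radius of the ball with the volume of `Ω`.
  set s : ℝ := (V / a) ^ (1 / (d : ℝ)) with hs
  have hspos : 0 < s := by positivity
  have hsd : s ^ d = V / a := by
    rw [hs, ← Real.rpow_natCast, ← Real.rpow_mul (by positivity), one_div_mul_cancel hdr.ne',
      Real.rpow_one]
  have hs2 : a ^ (2 * (m : ℝ) / (d : ℝ)) * V ^ (-(2 * (m : ℝ)) / (d : ℝ)) = s⁻¹ ^ (2 * m) := by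
    rw [inv_pow, hs, ← Real.rpow_natCast, ← Real.rpow_mul (by positivity), ← Real.rpow_neg
      (by positivity), neg_div, show -(1 / (d : ℝ) * ((2 * m : ℕ) : ℝ)) = -(2 * (m : ℝ) / d) by
        push_cast; ring, Real.div_rpow hVpos.le hapos.le, Real.rpow_neg hapos.le]
    field_simp
  set b : Metric.sphere (0 : E) 1 → ℝ :=
    fun θ => (rayLength Ω x θ + rayLength Ω x (-(θ : E))) / 2 with hbdef
  have hθ0 : ∀ θ : Metric.sphere (0 : E) 1, (θ : E) ≠ 0 := by
    intro θ h
    have := θ.2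
    simp [h] at this
  have hr1 : ∀ θ : Metric.sphere (0 : E) 1, 0 < rayLength Ω x θ :=
    fun θ => rayLength_pos ho hb hx (hθ0 θ)
  have hr2 : ∀ θ : Metric.sphere (0 : E) 1, 0 < rayLength Ω x (-(θ : E)) :=
    fun θ => rayLength_pos ho hb hx (neg_ne_zero.2 (hθ0 θ))
  have hbpos : ∀ θ, 0 < b θ := fun θ => by have := hr1 θ; have := hr2 θ; positivity
  have hm1 : Measurable fun θ : Metric.sphere (0 : E) 1 => rayLength Ω x (θ : E) :=
    (measurable_rayLength ho hc hb (S := Metric.sphere (0 : E) 1) (by simp)).comp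
      (f := fun θ => (x, θ)) (by fun_prop)
  have hm2 : Measurable fun θ : Metric.sphere (0 : E) 1 => rayLength Ω x (-(θ : E)) :=
    (measurable_rayLength_neg ho hc hb).comp (f := fun θ => (x, θ)) (by fun_prop)
  have hbm : Measurable b := (hm1.add hm2).div_const 2
  have hbint : ∫⁻ θ, ENNReal.ofReal (b θ ^ d) ∂μ.toSphere ≤ ENNReal.ofReal (d * V) := by
    have i1 := lintegral_rayLength_pow μ ho hc hb hx 1 (Or.inl rfl)
    have i2 := lintegral_rayLength_pow μ ho hc hb hx (-1) (Or.inr rfl)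
    simp only [one_smul, neg_smul] at i1 i2
    have hΩV : μ Ω = ENNReal.ofReal V := (ofReal_measureReal hb.measure_lt_top.ne).symm
    rw [hΩV, ← ENNReal.ofReal_mul (by positivity)] at i1 i2
    calc ∫⁻ θ, ENNReal.ofReal (b θ ^ d) ∂μ.toSphere
        ≤ ∫⁻ θ : Metric.sphere (0 : E) 1, ENNReal.ofReal (1 / 2) *
          (ENNReal.ofReal (rayLength Ω x θ ^ d) +
            ENNReal.ofReal (rayLength Ω x (-(θ : E)) ^ d)) ∂μ.toSphere := by
          refine lintegral_mono fun θ => ?_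
          have h1 := (hr1 θ).le
          have h2 := (hr2 θ).le
          rw [← ENNReal.ofReal_add (by positivity) (by positivity), ← ENNReal.ofReal_mul
            (by norm_num)]
          refine ENNReal.ofReal_le_ofReal ?_
          -- Convexity of the `d`-th power passes from the two rays to the half chord.
          have := add_pow_le h1 h2 d
          simp only [hbdef, div_pow]
          rw [div_le_iff₀ (by positivity)]
          refine this.trans (le_of_eq ?_)
          obtain ⟨n, hn⟩ : ∃ n, d = n + 1 := ⟨d - 1, by omega⟩
          rw [hn, Nat.add_sub_cancel, pow_succ]
          ring
      _ = ENNReal.ofReal (d * V) := by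
          rw [lintegral_const_mul' _ _ ENNReal.ofReal_ne_top, lintegral_add_left (by fun_prop), i1,
            i2, ← ENNReal.ofReal_add (by positivity) (by positivity),
            ← ENNReal.ofReal_mul (by norm_num)]
          congr 1
          ring
  set I := ∫⁻ θ, ENNReal.ofReal ((b θ)⁻¹ ^ (2 * m)) ∂μ.toSphere with hI
  have hgoal : ∫⁻ θ : Metric.sphere (0 : E) 1, ENNReal.ofReal
      ((2 / (rayLength Ω x θ + rayLength Ω x (-(θ : E)))) ^ (2 * m)) ∂μ.toSphere = I := by
    refine lintegral_congr fun θ => ?_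
    simp only [hbdef, inv_div]
  rw [hgoal, hs2, hσ]
  -- The pointwise inequality at `y = b θ / s` is integrated and multiplied through. Because `∫ b^d
  -- ≤ d V = d a s^d`, its last term is at most `2m` times the area of the sphere, which then
  -- cancels on both sides.
  have key : ENNReal.ofReal (d * a) * ENNReal.ofReal (d + 2 * m) ≤
      ENNReal.ofReal (d * s ^ (2 * m)) * I + ENNReal.ofReal (d * a) * ENNReal.ofReal (2 * m) := by
    calc ENNReal.ofReal (d * a) * ENNReal.ofReal (d + 2 * m)
        = ∫⁻ _ : Metric.sphere (0 : E) 1, ENNReal.ofReal (d + 2 * m) ∂μ.toSphere := by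
          rw [lintegral_const, hσ, mul_comm]
      _ ≤ ∫⁻ θ, (ENNReal.ofReal (d * s ^ (2 * m)) * ENNReal.ofReal ((b θ)⁻¹ ^ (2 * m)) +
            ENNReal.ofReal (2 * m / s ^ d) * ENNReal.ofReal (b θ ^ d)) ∂μ.toSphere := by
          refine lintegral_mono fun θ => ?_
          have hb0 := hbpos θ
          rw [← ENNReal.ofReal_mul (by positivity), ← ENNReal.ofReal_mul (by positivity),
            ← ENNReal.ofReal_add (by positivity) (by positivity)]
          refine ENNReal.ofReal_le_ofReal
            ((add_le_weighted_pow d m (y := b θ / s) (by positivity)).trans (le_of_eq ?_))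
          generalize b θ = β at *
          rw [inv_div, div_pow, div_pow, inv_pow]
          field_simp
      _ = ENNReal.ofReal (d * s ^ (2 * m)) * I +
            ENNReal.ofReal (2 * m / s ^ d) * ∫⁻ θ, ENNReal.ofReal (b θ ^ d) ∂μ.toSphere := by
          rw [lintegral_add_left (by fun_prop), lintegral_const_mul' _ _ ENNReal.ofReal_ne_top,
            lintegral_const_mul' _ _ ENNReal.ofReal_ne_top]
      _ ≤ ENNReal.ofReal (d * s ^ (2 * m)) * I +
            ENNReal.ofReal (2 * m / s ^ d) * ENNReal.ofReal (d * V) := by gcongr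
      _ = _ := by
          rw [← ENNReal.ofReal_mul (by positivity), ← ENNReal.ofReal_mul (by positivity), hsd]
          congr 2
          field_simp
  rw [ENNReal.ofReal_add (by positivity) (by positivity), mul_add] at key
  have key2 := (ENNReal.add_le_add_iff_right (ENNReal.mul_ne_top ENNReal.ofReal_ne_top
    ENNReal.ofReal_ne_top)).1 key
  have hne : ENNReal.ofReal (d * s ^ (2 * m)) ≠ 0 := by
    rw [Ne, ENNReal.ofReal_eq_zero, not_le]; positivity
  refine (ENNReal.mul_le_mul_iff_right hne ENNReal.ofReal_ne_top).1 (le_trans (le_of_eq ?_) key2)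
  rw [← ENNReal.ofReal_mul (by positivity), ← ENNReal.ofReal_mul (by positivity),
    ← ENNReal.ofReal_mul (by positivity), inv_pow]
  congr 1
  field_simp

end MeanChord

/-! ### Supporting hyperplanes and the distance to the boundary. -/

section Supporting

variable {E : Type*} [NormedAddCommGroup E] [InnerProductSpace ℝ E] [FiniteDimensional ℝ E]

/-- A supporting hyperplane at a nearest boundary point bounds the lengths of all rays. -/
lemma exists_normal_le_inv_rayLength [Nontrivial E] {Ω : Set E} (ho : IsOpen Ω)
    (hc : Convex ℝ Ω) (hb : Bornology.IsBounded Ω) {x : E} (hx : x ∈ Ω) :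
    ∃ n : E, ‖n‖ = 1 ∧ ∀ θ : E, θ ≠ 0 →
      |inner ℝ n θ| * (Metric.infDist x (frontier Ω))⁻¹ ≤
        max (rayLength Ω x (-θ))⁻¹ (rayLength Ω x θ)⁻¹ := by
  have hne : (frontier Ω).Nonempty := by
    rw [nonempty_frontier_iff]
    refine ⟨⟨x, hx⟩, ?_⟩
    rintro rfl
    exact NormedSpace.unbounded_univ ℝ E hb
  obtain ⟨y, hy, hxy⟩ := isClosed_frontier.exists_infDist_eq_dist hne x
  have hyΩ : y ∉ Ω := by
    rw [ho.frontier_eq] at hy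
    exact hy.2
  obtain ⟨f, hf⟩ := geometric_hahn_banach_open_point hc ho hyΩ
  set v := (InnerProductSpace.toDual ℝ E).symm f with hv
  have hvf : ∀ z, inner ℝ v z = f z := fun z => InnerProductSpace.toDual_symm_apply
  have hv0 : v ≠ 0 := by
    intro h
    have := hf x hx
    rw [← hvf, ← hvf, h] at this
    simp at this
  have hvn : ‖v‖ ≠ 0 := norm_ne_zero_iff.2 hv0
  set n := ‖v‖⁻¹ • v with hn
  have hn1 : ‖n‖ = 1 := by rw [hn, norm_smul, norm_inv, norm_norm, inv_mul_cancel₀ hvn]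
  have hlt : ∀ z ∈ Ω, inner ℝ n z < inner ℝ n y := by
    intro z hz
    have := hf z hz
    rw [hn, real_inner_smul_left, real_inner_smul_left, hvf, hvf]
    exact mul_lt_mul_of_pos_left this (by positivity)
  rw [hxy]
  -- Only Cauchy–Schwarz is used; `n` need not be known to be parallel to `y - x`.
  have hle : inner ℝ n y - inner ℝ n x ≤ dist x y := by
    rw [← inner_sub_right]
    refine (real_inner_le_norm _ _).trans ?_
    rw [hn1, one_mul, dist_comm, dist_eq_norm]
  have hd : 0 < dist x y := by
    have := hlt x hx
    linarith
  have side : ∀ θ : E, θ ≠ 0 → inner ℝ n θ * (dist x y)⁻¹ ≤ (rayLength Ω x θ)⁻¹ := by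
    intro θ hθ
    have hr := rayLength_pos ho hb hx hθ
    by_contra! hcon
    have hpos : 0 < inner ℝ n θ := by
      by_contra! h
      have : inner ℝ n θ * (dist x y)⁻¹ ≤ 0 := mul_nonpos_of_nonpos_of_nonneg h (by positivity)
      have : 0 < (rayLength Ω x θ)⁻¹ := by positivity
      linarith
    -- If the ray were longer than this, its point at parameter `dist x y / ⟨n,θ⟩` would lie in `Ω`
    -- while having reached the supporting hyperplane.
    have h1 : dist x y / inner ℝ n θ < rayLength Ω x θ := by
      rw [div_lt_iff₀ hpos]
      rw [← div_eq_mul_inv, lt_div_iff₀ hd, inv_mul_lt_iff₀ hr] at hcon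
      exact hcon
    have h2 := hlt _ (mem_of_lt_rayLength hc hx (by positivity) h1)
    rw [inner_add_right, inner_smul_right, div_mul_cancel₀ _ hpos.ne'] at h2
    linarith
  refine ⟨n, hn1, fun θ hθ => ?_⟩
  rcases abs_cases (inner ℝ n θ) with ⟨h, -⟩ | ⟨h, -⟩ <;> rw [h]
  · exact (side θ hθ).trans (le_max_right _ _)
  · rw [← inner_neg_right]
    exact (side (-θ) (neg_ne_zero.2 hθ)).trans (le_max_left _ _)

end Supporting

/-! ### Plancherel identities, with real functions complexified for the Fourier transform. -/

section Plancherel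

open SchwartzMap LineDeriv FourierTransform Laplacian

variable {E : Type*} [NormedAddCommGroup E] [InnerProductSpace ℝ E]

/-- A real Schwartz function viewed as a complex one. -/
noncomputable abbrev complexify (U : 𝓢(E, ℝ)) : 𝓢(E, ℂ) := U.postcompCLM Complex.ofRealCLM

lemma lineDerivOp_complexify (U : 𝓢(E, ℝ)) (θ : E) :
    ∂_{θ} (complexify U) = complexify (∂_{θ} U) := by
  ext x
  have := (Complex.ofRealCLM.hasFDerivAt.comp x (U.hasFDerivAt x)).fderiv
  rw [lineDerivOp_apply_eq_fderiv, SchwartzMap.postcompCLM_apply, lineDerivOp_apply_eq_fderiv]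
  change fderiv ℝ (Complex.ofRealCLM ∘ U) x θ = _
  rw [this]
  rfl

lemma iterate_lineDerivOp_complexify (U : 𝓢(E, ℝ)) (θ : E) (m : ℕ) :
    ∂_{θ}^[m] (complexify U) = complexify (∂_{θ}^[m] U) := by
  induction m with
  | zero => rfl
  | succ m ih =>
    rw [Function.iterate_succ_apply', ih, lineDerivOp_complexify, Function.iterate_succ_apply']

variable [FiniteDimensional ℝ E]

lemma laplacian_complexify (U : 𝓢(E, ℝ)) : Δ (complexify U) = complexify (Δ U) := by
  rw [SchwartzMap.laplacian_eq_sum (stdOrthonormalBasis ℝ E),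
    SchwartzMap.laplacian_eq_sum (stdOrthonormalBasis ℝ E)]
  simp only [lineDerivOp_complexify]
  ext x
  simp

lemma iterate_laplacian_complexify (U : 𝓢(E, ℝ)) (m : ℕ) :
    Δ^[m] (complexify U) = complexify (Δ^[m] U) := by
  induction m with
  | zero => rfl
  | succ m ih =>
    rw [Function.iterate_succ_apply', ih, laplacian_complexify, Function.iterate_succ_apply']

lemma iterate_laplacian_apply (U : 𝓢(E, ℝ)) (m : ℕ) :
    ⇑(Δ^[m] U) = Δ^[m] (⇑U) := by
  induction m with
  | zero => rfl
  | succ m ih =>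
    ext x
    rw [Function.iterate_succ_apply', SchwartzMap.laplacian_apply, ih, Function.iterate_succ_apply']

lemma norm_gradient_sq_eq_sum (U : 𝓢(E, ℝ)) (x : E) :
    ‖gradient U x‖ ^ 2 = ∑ i, (∂_{stdOrthonormalBasis ℝ E i} U) x ^ 2 := by
  rw [← (stdOrthonormalBasis ℝ E).sum_sq_inner_left (gradient U x)]
  refine Finset.sum_congr rfl fun i _ => ?_
  rw [gradient, InnerProductSpace.toDual_symm_apply, SchwartzMap.lineDerivOp_apply_eq_fderiv]

variable [MeasurableSpace E] [BorelSpace E]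

lemma fourier_lineDerivOp_apply (v : 𝓢(E, ℂ)) (θ ξ : E) :
    𝓕 (∂_{θ} v) ξ = (2 * Real.pi * Complex.I * (inner ℝ ξ θ : ℝ)) * 𝓕 v ξ := by
  have : (fun x : E => (inner ℝ x θ : ℝ)).HasTemperateGrowth :=
    ((innerSL ℝ).flip θ).hasTemperateGrowth
  rw [SchwartzMap.fourier_lineDerivOp_eq, smul_apply,
    SchwartzMap.smulLeftCLM_apply_apply this, smul_eq_mul, Complex.real_smul]
  ring

lemma fourier_iterate_lineDerivOp_apply (v : 𝓢(E, ℂ)) (θ ξ : E) (m : ℕ) :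
    𝓕 (∂_{θ}^[m] v) ξ = (2 * Real.pi * Complex.I * (inner ℝ ξ θ : ℝ)) ^ m * 𝓕 v ξ := by
  induction m with
  | zero => simp
  | succ m ih =>
    rw [Function.iterate_succ_apply', fourier_lineDerivOp_apply, ih, pow_succ]
    ring

lemma fourier_laplacian_apply (v : 𝓢(E, ℂ)) (ξ : E) :
    𝓕 (Δ v) ξ = (-((2 * Real.pi) ^ 2 * ‖ξ‖ ^ 2 : ℝ) : ℂ) * 𝓕 v ξ := by
  have h : 𝓕 (Δ v) = ∑ i, 𝓕 (∂_{stdOrthonormalBasis ℝ E i} (∂_{stdOrthonormalBasis ℝ E i} v)) := by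
    rw [SchwartzMap.laplacian_eq_sum (stdOrthonormalBasis ℝ E)]
    exact map_sum (SchwartzMap.fourierTransformCLM ℂ) _ _
  rw [h, sum_apply, ← (stdOrthonormalBasis ℝ E).sum_sq_inner_left ξ]
  simp only [fourier_lineDerivOp_apply]
  push_cast
  rw [Finset.mul_sum, ← Finset.sum_neg_distrib, Finset.sum_mul]
  refine Finset.sum_congr rfl fun i _ => ?_
  linear_combination (4 * (Real.pi : ℂ) ^ 2 *
    (inner ℝ ξ (stdOrthonormalBasis ℝ E i) : ℂ) ^ 2 * 𝓕 v ξ) * Complex.I_sq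

lemma fourier_iterate_laplacian_apply (v : 𝓢(E, ℂ)) (ξ : E) (m : ℕ) :
    𝓕 (Δ^[m] v) ξ = (-((2 * Real.pi) ^ 2 * ‖ξ‖ ^ 2 : ℝ) : ℂ) ^ m * 𝓕 v ξ := by
  induction m with
  | zero => simp
  | succ m ih =>
    rw [Function.iterate_succ_apply', fourier_laplacian_apply, ih, pow_succ]
    ring

lemma lintegral_sq_eq_fourier (U : 𝓢(E, ℝ)) :
    ∫⁻ x, ENNReal.ofReal (U x ^ 2) = ∫⁻ ξ, ENNReal.ofReal (‖𝓕 (complexify U) ξ‖ ^ 2) := by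
  have h1 : ∀ w : 𝓢(E, ℂ), Integrable fun x => ‖w x‖ ^ 2 := fun w =>
    (memLp_two_iff_integrable_sq_norm w.continuous.aestronglyMeasurable).1 (w.memLp 2)
  have h2 := SchwartzMap.integral_norm_sq_fourier (complexify U)
  have h3 : ∀ x, U x ^ 2 = ‖complexify U x‖ ^ 2 := fun x => by simp
  simp only [h3]
  rw [← ofReal_integral_eq_lintegral_ofReal (h1 _) (ae_of_all _ fun x => by positivity),
    ← ofReal_integral_eq_lintegral_ofReal (h1 _) (ae_of_all _ fun x => by positivity), h2]

/-- Plancherel's identity for iterated directional derivatives. -/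
lemma lintegral_iterate_lineDerivOp_sq (U : 𝓢(E, ℝ)) (θ : E) (m : ℕ) :
    ∫⁻ x, ENNReal.ofReal ((∂_{θ}^[m] U) x ^ 2) =
      ∫⁻ ξ, ENNReal.ofReal ((2 * Real.pi) ^ (2 * m) * ‖𝓕 (complexify U) ξ‖ ^ 2) *
        ENNReal.ofReal (inner ℝ ξ θ ^ (2 * m)) := by
  rw [lintegral_sq_eq_fourier, ← iterate_lineDerivOp_complexify]
  refine lintegral_congr fun ξ => ?_
  rw [fourier_iterate_lineDerivOp_apply, ← ENNReal.ofReal_mul (by positivity)]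
  congr 1
  rw [norm_mul, norm_pow]
  have : ‖(2 * Real.pi * Complex.I * (inner ℝ ξ θ : ℝ) : ℂ)‖ ^ 2 =
      (2 * Real.pi) ^ 2 * inner ℝ ξ θ ^ 2 := by
    simp [mul_pow]
  rw [mul_pow, ← pow_mul, mul_comm m 2, pow_mul, this, pow_mul, pow_mul, mul_pow]
  ring

lemma lintegral_iterate_laplacian_sq (U : 𝓢(E, ℝ)) (k : ℕ) :
    ∫⁻ x, ENNReal.ofReal ((Δ^[k] U) x ^ 2) =
      ∫⁻ ξ, ENNReal.ofReal ((2 * Real.pi) ^ (2 * (2 * k)) * ‖𝓕 (complexify U) ξ‖ ^ 2) *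
        ENNReal.ofReal (‖ξ‖ ^ (2 * (2 * k))) := by
  rw [lintegral_sq_eq_fourier, ← iterate_laplacian_complexify]
  refine lintegral_congr fun ξ => ?_
  rw [fourier_iterate_laplacian_apply, ← ENNReal.ofReal_mul (by positivity)]
  congr 1
  rw [norm_mul, norm_pow, norm_neg, Complex.norm_real, Real.norm_eq_abs,
    abs_of_nonneg (by positivity), ← mul_pow, ← pow_mul, mul_pow, ← pow_mul, mul_pow]
  ring

lemma lintegral_gradient_iterate_laplacian_sq (U : 𝓢(E, ℝ)) (k : ℕ) :
    ∫⁻ x, ENNReal.ofReal (‖gradient (Δ^[k] U) x‖ ^ 2) =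
      ∫⁻ ξ, ENNReal.ofReal ((2 * Real.pi) ^ (2 * (2 * k + 1)) * ‖𝓕 (complexify U) ξ‖ ^ 2) *
        ENNReal.ofReal (‖ξ‖ ^ (2 * (2 * k + 1))) := by
  obtain ⟨w, hw⟩ : ∃ w : 𝓢(E, ℝ), w = Δ^[k] U := ⟨_, rfl⟩
  rw [← iterate_laplacian_apply, ← hw]
  have hc : Continuous (𝓕 (complexify w) : 𝓢(E, ℂ)) := SchwartzMap.continuous _
  have hm : ∀ i, Measurable fun x => ENNReal.ofReal
      ((∂_{stdOrthonormalBasis ℝ E i} w) x ^ 2) := by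
    intro i
    have := (∂_{stdOrthonormalBasis ℝ E i} w : 𝓢(E, ℝ)).continuous
    fun_prop
  simp only [norm_gradient_sq_eq_sum]
  have e : ∀ i, ∫⁻ x, ENNReal.ofReal ((∂_{stdOrthonormalBasis ℝ E i} w) x ^ 2) =
      ∫⁻ ξ, ENNReal.ofReal ((2 * Real.pi) ^ 2 * ‖𝓕 (complexify w) ξ‖ ^ 2) *
        ENNReal.ofReal (inner ℝ ξ (stdOrthonormalBasis ℝ E i) ^ 2) := fun i => by
    simpa using lintegral_iterate_lineDerivOp_sq w (stdOrthonormalBasis ℝ E i) 1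
  calc ∫⁻ x, ENNReal.ofReal (∑ i, (∂_{stdOrthonormalBasis ℝ E i} w) x ^ 2)
      = ∑ i, ∫⁻ x, ENNReal.ofReal ((∂_{stdOrthonormalBasis ℝ E i} w) x ^ 2) := by
        rw [← lintegral_finsetSum _ fun i _ => hm i]
        exact lintegral_congr fun x => ENNReal.ofReal_sum_of_nonneg fun i _ => sq_nonneg _
    _ = ∫⁻ ξ, ∑ i, ENNReal.ofReal ((2 * Real.pi) ^ 2 * ‖𝓕 (complexify w) ξ‖ ^ 2) *
          ENNReal.ofReal (inner ℝ ξ (stdOrthonormalBasis ℝ E i) ^ 2) := by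
        simp only [e]
        rw [lintegral_finsetSum _ fun i _ => by fun_prop]
    _ = _ := by
        refine lintegral_congr fun ξ => ?_
        rw [← Finset.mul_sum, ← ENNReal.ofReal_sum_of_nonneg fun i _ => sq_nonneg _,
          (stdOrthonormalBasis ℝ E).sum_sq_inner_left, ← ENNReal.ofReal_mul (by positivity),
          ← ENNReal.ofReal_mul (by positivity), hw, ← iterate_laplacian_complexify,
          fourier_iterate_laplacian_apply, norm_mul, norm_pow, norm_neg, Complex.norm_real,
          Real.norm_eq_abs, abs_of_nonneg (by positivity),
          ← mul_pow (2 * Real.pi) ‖ξ‖ 2, ← pow_mul (2 * Real.pi * ‖ξ‖) 2 k]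
        congr 1
        ring

/-- Plancherel's identity for the polyharmonic energy. -/
lemma lintegral_energyDensity {N : ℕ} (U : 𝓢(EuclideanSpace ℝ (Fin N), ℝ)) (m : ℕ) :
    ∫⁻ x, ENNReal.ofReal (energyDensity m U x) =
      ∫⁻ ξ, ENNReal.ofReal ((2 * Real.pi) ^ (2 * m) * ‖𝓕 (complexify U) ξ‖ ^ 2) *
        ENNReal.ofReal (‖ξ‖ ^ (2 * m)) := by
  rcases Nat.even_or_odd' m with ⟨k, rfl | rfl⟩
  · simp only [energyDensity, even_two_mul, if_true, Nat.mul_div_cancel_left k two_pos]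
    rw [← lintegral_iterate_laplacian_sq, iterate_laplacian_apply]
  · have h1 : ¬ Even (2 * k + 1) := by simp
    have h2 : (2 * k + 1) / 2 = k := by omega
    simp only [energyDensity, h1, if_false, h2]
    rw [← lintegral_gradient_iterate_laplacian_sq]

/-- The energy as an average over all directions of energies of directional derivatives. -/
lemma lintegral_sphere_lineDerivOp_sq {N : ℕ} (hN : 1 ≤ N)
    (U : 𝓢(EuclideanSpace ℝ (Fin N), ℝ)) (m : ℕ) :
    (∫⁻ θ : Metric.sphere (0 : EuclideanSpace ℝ (Fin N)) 1,
      (∫⁻ x, ENNReal.ofReal ((∂_{(θ : EuclideanSpace ℝ (Fin N))}^[m] U) x ^ 2))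
        ∂(volume : Measure (EuclideanSpace ℝ (Fin N))).toSphere) *
        ENNReal.ofReal (∏ j ∈ Finset.Icc 1 m, ((N : ℝ) + 2 * (j : ℝ) - 2)) =
      ((volume : Measure (EuclideanSpace ℝ (Fin N))).toSphere Set.univ *
        ENNReal.ofReal (∏ j ∈ Finset.Icc 1 m, (2 * (j : ℝ) - 1))) *
          ∫⁻ x, ENNReal.ofReal (energyDensity m U x) := by
  have : NeZero N := ⟨by omega⟩
  have hc : Continuous (𝓕 (complexify U) : 𝓢(EuclideanSpace ℝ (Fin N), ℂ)) :=
    SchwartzMap.continuous _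
  simp only [lintegral_iterate_lineDerivOp_sq]
  -- After exchanging integrals, the inner one is the `2m`-th spherical moment of `⟨ξ, ·⟩`,
  -- proportional to `‖ξ‖^(2m)`.
  rw [lintegral_lintegral_swap (by fun_prop), lintegral_energyDensity,
    ← lintegral_mul_const' _ _ ENNReal.ofReal_ne_top, ← lintegral_const_mul _ (by fun_prop)]
  refine lintegral_congr fun ξ => ?_
  have := lintegral_sphere_inner_pow (volume : Measure (EuclideanSpace ℝ (Fin N))) m ξ
  rw [finrank_euclideanSpace_fin] at this
  rw [lintegral_const_mul' _ _ ENNReal.ofReal_ne_top, mul_assoc, this]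
  ring

end Plancherel

/-! ### Support and continuity of the energy density. -/

section Support

open Laplacian

lemma tsupport_laplacian_subset {E : Type*} [NormedAddCommGroup E] [InnerProductSpace ℝ E]
    [FiniteDimensional ℝ E] (f : E → ℝ) : tsupport (Δ f) ⊆ tsupport f := by
  refine closure_minimal (fun x hx => ?_) (isClosed_tsupport f)
  by_contra h
  rw [notMem_tsupport_iff_eventuallyEq] at h
  have := (InnerProductSpace.laplacian_congr_nhds h).self_of_nhds
  refine hx (this.trans ?_)
  exact congrFun (InnerProductSpace.laplacian_const (c := (0 : ℝ))) x

lemma tsupport_iterate_laplacian_subset {E : Type*} [NormedAddCommGroup E] [InnerProductSpace ℝ E]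
    [FiniteDimensional ℝ E] (f : E → ℝ) (k : ℕ) : tsupport (Δ^[k] f) ⊆ tsupport f := by
  induction k with
  | zero => rfl
  | succ k ih =>
    rw [Function.iterate_succ_apply']
    exact (tsupport_laplacian_subset _).trans ih

lemma energyDensity_nonneg {N : ℕ} (m : ℕ) (u : EuclideanSpace ℝ (Fin N) → ℝ)
    (x : EuclideanSpace ℝ (Fin N)) : 0 ≤ energyDensity m u x := by
  unfold energyDensity
  split_ifs <;> positivity

lemma energyDensity_eq_zero {N : ℕ} (m : ℕ) {u : EuclideanSpace ℝ (Fin N) → ℝ}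
    {x : EuclideanSpace ℝ (Fin N)} (hx : x ∉ tsupport u) : energyDensity m u x = 0 := by
  have hx' : x ∉ tsupport (Δ^[m / 2] u) := fun h => hx (tsupport_iterate_laplacian_subset u _ h)
  unfold energyDensity
  split_ifs
  · simp [image_eq_zero_of_notMem_tsupport hx']
  · simp [gradient, fderiv_of_notMem_tsupport (𝕜 := ℝ) hx']

lemma continuous_energyDensity {N : ℕ} (m : ℕ) (U : SchwartzMap (EuclideanSpace ℝ (Fin N)) ℝ) :
    Continuous (energyDensity m U) := by
  obtain ⟨w, hw⟩ : ∃ w : SchwartzMap (EuclideanSpace ℝ (Fin N)) ℝ, w = Δ^[m / 2] U := ⟨_, rfl⟩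
  have h : ∀ x, energyDensity m U x = if Even m then w x ^ 2 else ‖gradient w x‖ ^ 2 := by
    intro x
    rw [energyDensity, ← iterate_laplacian_apply, hw]
  rw [funext h]
  split_ifs
  · exact (SchwartzMap.continuous _).pow 2
  · refine (Continuous.norm ?_).pow 2
    exact (LinearIsometryEquiv.continuous _).comp
      ((w.smooth ⊤).continuous_fderiv (by simp))

end Support

/-! ### Averaging over directions. -/

section Main

variable {N : ℕ}

lemma prod_odd_pos (m : ℕ) : 0 < ∏ j ∈ Finset.Icc 1 m, (2 * (j : ℝ) - 1) := by
  refine Finset.prod_pos fun j hj => ?_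
  have : (1 : ℝ) ≤ j := by exact_mod_cast (Finset.mem_Icc.1 hj).1
  linarith

lemma prod_dim_pos (hN : 1 ≤ N) (m : ℕ) :
    0 < ∏ j ∈ Finset.Icc 1 m, ((N : ℝ) + 2 * (j : ℝ) - 2) := by
  refine Finset.prod_pos fun j hj => ?_
  have : (1 : ℝ) ≤ j := by exact_mod_cast (Finset.mem_Icc.1 hj).1
  have : (1 : ℝ) ≤ N := by exact_mod_cast hN
  linarith

lemma constA_pos (m : ℕ) : 0 < constA m := by
  unfold constA
  refine div_pos (Finset.prod_pos fun j hj => ?_) (by positivity)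
  have : (1 : ℝ) ≤ j := by exact_mod_cast (Finset.mem_Icc.1 hj).1
  exact pow_pos (by linarith) 2

lemma constGamma_nonneg (hN : 1 ≤ N) (m : ℕ) : 0 ≤ constGamma N m := by
  have h1 := (prod_odd_pos m).le
  have h2 := (prod_dim_pos hN m).le
  have h3 : 0 ≤ unitBallVolume N := measureReal_nonneg
  unfold constGamma
  positivity

/-- The average over all directions of the one-dimensional weights dominates the weight of the
Hardy–Rellich inequality. -/
lemma le_lintegral_rayWeight (hN : 1 ≤ N) (m : ℕ) {Ω : Set (EuclideanSpace ℝ (Fin N))}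
    (ho : IsOpen Ω) (hc : Convex ℝ Ω) (hb : Bornology.IsBounded Ω) {x : EuclideanSpace ℝ (Fin N)}
    (hx : x ∈ Ω) :
    ENNReal.ofReal (constA m * (bdryDist Ω x)⁻¹ ^ (2 * m) +
      constGamma N m * volume.real Ω ^ (-(2 * (m : ℝ)) / (N : ℝ))) *
        ((volume : Measure (EuclideanSpace ℝ (Fin N))).toSphere Set.univ *
        ENNReal.ofReal (∏ j ∈ Finset.Icc 1 m, (2 * (j : ℝ) - 1))) ≤
      (∫⁻ θ : Metric.sphere (0 : EuclideanSpace ℝ (Fin N)) 1, ENNReal.ofReal (rayWeight m Ω x θ)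
        ∂(volume : Measure (EuclideanSpace ℝ (Fin N))).toSphere) *
        ENNReal.ofReal (∏ j ∈ Finset.Icc 1 m, ((N : ℝ) + 2 * (j : ℝ) - 2)) := by
  have : NeZero N := ⟨by omega⟩
  set σ := (volume : Measure (EuclideanSpace ℝ (Fin N))).toSphere with hσ
  obtain ⟨n, hn1, hn⟩ := exists_normal_le_inv_rayLength ho hc hb hx
  have hmom := lintegral_sphere_inner_pow (volume : Measure (EuclideanSpace ℝ (Fin N))) m n
  have hch := le_lintegral_half_chord (volume : Measure (EuclideanSpace ℝ (Fin N))) m ho hc hb hx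
  rw [finrank_euclideanSpace_fin] at hmom hch
  rw [hn1, one_pow, ENNReal.ofReal_one, one_mul, ← hσ] at hmom
  rw [← hσ] at hch
  have hPo := prod_odd_pos m
  have hPd := prod_dim_pos hN m
  have hA := constA_nonneg m
  have hB := remainderConst_nonneg m
  have hG := constGamma_nonneg hN m
  have hdist : 0 ≤ bdryDist Ω x := Metric.infDist_nonneg
  set Po := ∏ j ∈ Finset.Icc 1 m, (2 * (j : ℝ) - 1) with hPodef
  set Pd := ∏ j ∈ Finset.Icc 1 m, ((N : ℝ) + 2 * (j : ℝ) - 2) with hPddef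
  set c := volume.real (Metric.ball (0 : EuclideanSpace ℝ (Fin N)) 1) ^ (2 * (m : ℝ) / (N : ℝ)) *
        volume.real Ω ^ (-(2 * (m : ℝ)) / (N : ℝ)) with hcdef
  have hc0 : 0 ≤ c := by positivity
  -- The product quotient in `constGamma` is the inverse of the spherical moment, so after clearing
  -- denominators only `remainderConst m` and the ball constant remain.
  have hGc : constGamma N m * volume.real Ω ^ (-(2 * (m : ℝ)) / (N : ℝ)) * Po =
      remainderConst m * c * Pd := by
    rw [hcdef, constGamma, remainderConst, ← hPodef, ← hPddef, unitBallVolume]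
    field_simp
  have hθ0 : ∀ θ : Metric.sphere (0 : EuclideanSpace ℝ (Fin N)) 1,
      (θ : EuclideanSpace ℝ (Fin N)) ≠ 0 := by
    intro θ h
    have := θ.2
    simp [h] at this
  calc _ = ENNReal.ofReal (constA m * (bdryDist Ω x)⁻¹ ^ (2 * m)) * (σ Set.univ * ENNReal.ofReal Po)
        + σ Set.univ * ENNReal.ofReal (remainderConst m * c * Pd) := by
        rw [ENNReal.ofReal_add (by positivity) (by positivity), add_mul, ← hGc,
          ENNReal.ofReal_mul (p := constGamma N m * _) (by positivity)]
        ring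
    _ = (ENNReal.ofReal (constA m * (bdryDist Ω x)⁻¹ ^ (2 * m)) *
          (∫⁻ θ : Metric.sphere (0 : EuclideanSpace ℝ (Fin N)) 1,
            ENNReal.ofReal (inner ℝ n (θ : EuclideanSpace ℝ (Fin N)) ^ (2 * m)) ∂σ) +
          ENNReal.ofReal (remainderConst m) * (σ Set.univ * ENNReal.ofReal c)) *
          ENNReal.ofReal Pd := by
        rw [← hmom, ENNReal.ofReal_mul (p := remainderConst m * c) (by positivity),
          ENNReal.ofReal_mul hB]
        ring
    _ ≤ (ENNReal.ofReal (constA m * (bdryDist Ω x)⁻¹ ^ (2 * m)) *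
          (∫⁻ θ : Metric.sphere (0 : EuclideanSpace ℝ (Fin N)) 1,
            ENNReal.ofReal (inner ℝ n (θ : EuclideanSpace ℝ (Fin N)) ^ (2 * m)) ∂σ) +
          ENNReal.ofReal (remainderConst m) * ∫⁻ θ : Metric.sphere (0 : EuclideanSpace ℝ (Fin N)) 1,
            ENNReal.ofReal ((2 / (rayLength Ω x θ +
              rayLength Ω x (-(θ : EuclideanSpace ℝ (Fin N))))) ^ (2 * m)) ∂σ) *
          ENNReal.ofReal Pd := by gcongr
    _ ≤ _ := by
        gcongr
        rw [← lintegral_const_mul _ (by fun_prop),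
          ← lintegral_const_mul' _ _ ENNReal.ofReal_ne_top, ← lintegral_add_left (by fun_prop)]
        refine lintegral_mono fun θ => ?_
        have h1 := (rayLength_pos ho hb hx (hθ0 θ)).le
        have h2 := (rayLength_pos ho hb hx (neg_ne_zero.2 (hθ0 θ))).le
        have hinn : 0 ≤ inner ℝ n (θ : EuclideanSpace ℝ (Fin N)) ^ (2 * m) :=
          (even_two_mul m).pow_nonneg _
        rw [← ENNReal.ofReal_mul (by positivity), ← ENNReal.ofReal_mul (by positivity),
          ← ENNReal.ofReal_add (by positivity) (by positivity)]
        refine ENNReal.ofReal_le_ofReal ?_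
        rw [rayWeight]
        refine add_le_add_left ?_ _
        -- The exponent is even, so the bound on `|⟨n,θ⟩|` can be raised to the power `2m`.
        rw [mul_assoc, ← (even_two_mul m).pow_abs (inner ℝ n _), ← mul_pow, mul_comm _⁻¹]
        have := hn _ (hθ0 θ)
        unfold bdryDist
        gcongr

/-- The Hardy–Rellich inequality in terms of lower integrals. -/
lemma lintegral_hardyRellich (hN : 1 ≤ N) (m : ℕ) {Ω : Set (EuclideanSpace ℝ (Fin N))}
    (ho : IsOpen Ω) (hc : Convex ℝ Ω) (hb : Bornology.IsBounded Ω)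
    (U : SchwartzMap (EuclideanSpace ℝ (Fin N)) ℝ) (hU : tsupport U ⊆ Ω) :
    ∫⁻ x in Ω, ENNReal.ofReal (U x ^ 2 * (constA m * (bdryDist Ω x)⁻¹ ^ (2 * m) +
      constGamma N m * volume.real Ω ^ (-(2 * (m : ℝ)) / (N : ℝ)))) ≤
      ∫⁻ x, ENNReal.ofReal (energyDensity m U x) := by
  have : NeZero N := ⟨by omega⟩
  set σ := (volume : Measure (EuclideanSpace ℝ (Fin N))).toSphere with hσ
  have hPo := prod_odd_pos m
  have hne : σ Set.univ * ENNReal.ofReal (∏ j ∈ Finset.Icc 1 m, (2 * (j : ℝ) - 1)) ≠ 0 := by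
    refine mul_ne_zero ?_ (by simpa using hPo)
    rw [Ne, Measure.measure_univ_eq_zero]
    exact Measure.toSphere_ne_zero _
  have hnt : σ Set.univ * ENNReal.ofReal (∏ j ∈ Finset.Icc 1 m, (2 * (j : ℝ) - 1)) ≠ ⊤ :=
    ENNReal.mul_ne_top (measure_ne_top _ _) ENNReal.ofReal_ne_top
  -- Both sides are multiplied by the sphere's area times `1·3⋯(2m-1)`, positive and finite, so
  -- spherical integrals replace means.
  refine (ENNReal.mul_le_mul_iff_right hne hnt).1 ?_
  have hUc : Continuous U := U.continuous
  have hWm := measurable_rayWeight m ho hc hb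
  rw [hσ, ← lintegral_sphere_lineDerivOp_sq hN, ← hσ]
  calc _ = ∫⁻ x in Ω, ENNReal.ofReal (U x ^ 2) * (ENNReal.ofReal
          (constA m * (bdryDist Ω x)⁻¹ ^ (2 * m) +
            constGamma N m * volume.real Ω ^ (-(2 * (m : ℝ)) / (N : ℝ))) *
          (σ Set.univ * ENNReal.ofReal (∏ j ∈ Finset.Icc 1 m, (2 * (j : ℝ) - 1)))) := by
        rw [← lintegral_const_mul' _ _ hnt]
        refine lintegral_congr fun x => ?_
        rw [ENNReal.ofReal_mul (by positivity)]
        ring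
    _ ≤ ∫⁻ x in Ω, ENNReal.ofReal (U x ^ 2) *
          ((∫⁻ θ : Metric.sphere (0 : EuclideanSpace ℝ (Fin N)) 1,
            ENNReal.ofReal (rayWeight m Ω x θ) ∂σ) *
          ENNReal.ofReal (∏ j ∈ Finset.Icc 1 m, ((N : ℝ) + 2 * (j : ℝ) - 2))) := by
        refine setLIntegral_mono' ho.measurableSet fun x hx => ?_
        refine mul_le_mul_right ?_ _
        exact le_lintegral_rayWeight hN m ho hc hb hx
    _ = (∫⁻ x in Ω, (∫⁻ θ : Metric.sphere (0 : EuclideanSpace ℝ (Fin N)) 1,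
            ENNReal.ofReal (U x ^ 2 * rayWeight m Ω x θ) ∂σ)) *
          ENNReal.ofReal (∏ j ∈ Finset.Icc 1 m, ((N : ℝ) + 2 * (j : ℝ) - 2)) := by
        rw [← lintegral_mul_const' _ _ ENNReal.ofReal_ne_top]
        refine lintegral_congr fun x => ?_
        rw [← mul_assoc, ← lintegral_const_mul' _ _ ENNReal.ofReal_ne_top]
        congr 1
        refine lintegral_congr fun θ => ?_
        rw [ENNReal.ofReal_mul (by positivity)]
    _ = (∫⁻ θ : Metric.sphere (0 : EuclideanSpace ℝ (Fin N)) 1, (∫⁻ x in Ω,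
            ENNReal.ofReal (U x ^ 2 * rayWeight m Ω x θ)) ∂σ) *
          ENNReal.ofReal (∏ j ∈ Finset.Icc 1 m, ((N : ℝ) + 2 * (j : ℝ) - 2)) := by
        rw [lintegral_lintegral_swap]
        exact (((hUc.measurable.comp measurable_fst).pow_const 2).mul hWm).ennreal_ofReal.aemeasurable
    _ ≤ _ := by
        refine mul_le_mul_left (lintegral_mono fun θ => ?_) _
        exact lintegral_rayWeight_le volume m ho hc hb U hU (norm_eq_of_mem_sphere θ)

end Main

end HardyRellich

/-! ### From lower integrals to Bochner integrals. -/

theorem theorem2 (N m : ℕ) (hN : 1 ≤ N) (hm : 1 ≤ m)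
    (Ω : Set (EuclideanSpace ℝ (Fin N))) (hΩ_open : IsOpen Ω) (hΩ_convex : Convex ℝ Ω)
    (hΩ_bdd : Bornology.IsBounded Ω)
    (u : EuclideanSpace ℝ (Fin N) → ℝ) (hu_smooth : ContDiff ℝ ∞ u)
    (hu_compact : HasCompactSupport u) (hu_supp : tsupport u ⊆ Ω) :
    (∫ x in Ω, HardyRellich.energyDensity m u x) ≥
      HardyRellich.constA m * (∫ x in Ω, u x ^ 2 / HardyRellich.bdryDist Ω x ^ (2 * m)) +
        HardyRellich.constGamma N m * volume.real Ω ^ (-(2 * (m : ℝ)) / (N : ℝ)) *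
          (∫ x in Ω, u x ^ 2) := by
  open HardyRellich in
  set C := constGamma N m * volume.real Ω ^ (-(2 * (m : ℝ)) / (N : ℝ)) with hC
  have hC0 : 0 ≤ C := mul_nonneg (constGamma_nonneg hN m) (Real.rpow_nonneg measureReal_nonneg _)
  have hA := constA_pos m
  have huc : Continuous u := hu_smooth.continuous
  have main : ∫⁻ x in Ω, ENNReal.ofReal (u x ^ 2 * (constA m * (bdryDist Ω x)⁻¹ ^ (2 * m) + C)) ≤
      ∫⁻ x, ENNReal.ofReal (energyDensity m u x) :=
    lintegral_hardyRellich hN m hΩ_open hΩ_convex hΩ_bdd (hu_compact.toSchwartzMap hu_smooth) hu_supp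
  have hec : Continuous (energyDensity m u) :=
    continuous_energyDensity m (hu_compact.toSchwartzMap hu_smooth)
  have hez : ∀ x ∉ Ω, energyDensity m u x = 0 :=
    fun x hx => energyDensity_eq_zero m fun h => hx (hu_supp h)
  have hei : Integrable (energyDensity m u) :=
    hec.integrable_of_hasCompactSupport
      (HasCompactSupport.intro hu_compact fun x hx => energyDensity_eq_zero m hx)
  have hd0 : ∀ x, 0 ≤ bdryDist Ω x := fun x => Metric.infDist_nonneg
  rw [← ofReal_integral_eq_lintegral_ofReal hei (ae_of_all _ (energyDensity_nonneg m u)),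
    ← setIntegral_eq_integral_of_forall_compl_eq_zero hez] at main
  have hdm : Measurable (bdryDist Ω) := (Metric.continuous_infDist_pt _).measurable
  have hh0 : ∀ x, 0 ≤ u x ^ 2 * (constA m * (bdryDist Ω x)⁻¹ ^ (2 * m) + C) := fun x => by
    have := hd0 x
    positivity
  -- Integrability of the singular term is a consequence of the inequality itself, the energy being
  -- finite; without it the Bochner integral would default to `0`.
  have hhi : IntegrableOn (fun x => u x ^ 2 * (constA m * (bdryDist Ω x)⁻¹ ^ (2 * m) + C)) Ω := by
    refine ⟨(by fun_prop : Measurable _).aestronglyMeasurable, ?_⟩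
    rw [hasFiniteIntegral_iff_ofReal (ae_of_all _ hh0)]
    exact main.trans_lt ENNReal.ofReal_lt_top
  have hui : IntegrableOn (fun x => u x ^ 2) Ω :=
    ((huc.pow 2).integrable_of_hasCompactSupport
      (HasCompactSupport.intro hu_compact fun x hx => by
        simp [image_eq_zero_of_notMem_tsupport hx])).integrableOn
  -- The Hardy term is recovered by subtracting the remainder and dividing by `A(m) > 0`. Where the
  -- distance is zero, both forms of the quotient agree by the convention `0⁻¹ = 0`.
  have hdi : IntegrableOn (fun x => u x ^ 2 / bdryDist Ω x ^ (2 * m)) Ω := by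
    refine ((hhi.sub (hui.const_mul C)).const_mul (constA m)⁻¹).congr (ae_of_all _ fun x => ?_)
    simp only [Pi.sub_apply, inv_pow]
    field_simp
    ring
  rw [← ofReal_integral_eq_lintegral_ofReal hhi (ae_of_all _ hh0)] at main
  have hfin := (ENNReal.ofReal_le_ofReal_iff (integral_nonneg (energyDensity_nonneg m u))).1 main
  refine le_trans (le_of_eq ?_) hfin
  rw [← integral_const_mul, ← integral_const_mul,
    ← integral_add (hdi.const_mul _) (hui.const_mul _)]
  refine integral_congr_ae (ae_of_all _ fun x => ?_)
  simp only [inv_pow]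
  ring
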